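/- Let $0<\alpha<1$ be irrational and let $\Omega_\alpha\subset\{0,1\}^{\mathbb Z}$ be the Sturmian subshift, i.e. the closure of the set of sequences $(I_\alpha(t+n\alpha \bmod 1))_{n\in\mathbb Z}$, $t\in[0,1)$, where $I_\alpha=0$ on $[0,1-\alpha)$ and $I_\alpha=1$ on $[1-\alpha,1)$, with the shift $\sigma$. Let $(d_k)_{k\ge1}$ be positive integers and let $B$ be a properly ordered Bratteli diagram (there are a unique maximal and a unique minimal infinite path) of the following form: $V_0=\{v_0\}$; $V_n=\{1,2\}$ for $n\ge1$; there is one edge from $v_0$ to each vertex of $V_1$; for $k\ge1$ the incidence matrix between $V_k$ and $V_{k+1}$ is $\begin{pmatrix} d_k&1\\1&0\end{pmatrix}$ (rows indexed by $V_k$, columns by $V_{k+1}$), and the edge from $2\in V_k$ to $1\in V_{k+1}$ may have any position in the order of the $d_k+1$ edges ending at $1\in V_{k+1}$. Assume that the Bratteli–Vershik system $(X_B,V_B)$ is topologically conjugate to $(\Omega_\alpha,\sigma)$; the Dartnell–Durand–Maass representation of $\Omega_\alpha$ is of this kind. Let $\mu$ be a $V_B$-invariant Borel probability measure on $X_B$.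 Let $p_k/q_k=[0:d_1,\dots,d_k]$, $\beta=[0:d_1,d_2,\dots]=\lim_k p_k/q_k$, and let $G(x)=\{1/x\}$ be the Gauss map. Let $x=(x_1,x_2,\dots)\in X_B$, and let $I_n=[x_1\dots x_n]$ be the cylinder of all paths whose first $n$ edges are $x_1,\dots,x_n$. For $y\in X_B$ put $N_n(y)=\inf\{m>0: V_B^m(y)\in I_n\}$ and $F_n(t)=\mu\{y\in X_B:\mu(I_n)N_n(y)\le t\}$. Let $\mathcal M$ be an infinite set of integers $n\ge 1$ such that $x_n$ ends at the vertex $1$ for all $n\in\mathcal M$, and suppose that $$\lim_{n\to\infty,\,n\in\mathcal M}\frac{q_{n-3}}{q_{n-2}}=w,\qquad \lim_{n\to\infty,\,n\in\mathcal M}G^{n-2}(\beta)=\theta>0 .$$ Put $$h_1=\frac{(\lfloor 1/\theta\rfloor+w)\,\theta}{1+\theta w},\qquad h_2=\frac{(1+\lfloor 1/\theta\rfloor+w)\,\theta}{1+\theta w}.$$ Then $0<h_1\le1\le h_2$ and $h_1<h_2$, and for every $t\in\mathbb R$ the limit $F(t)=\lim_{n\to\infty,\,n\in\mathcal M}F_n(t)$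 exists and is the continuous piecewise linear function with $$F(t)=0\ (t\le0),\quad F(t)=t\ (0\le t\le h_1),\quad F(t)=h_1+\frac{(1-h_1)(t-h_1)}{h_2-h_1}\ (h_1\le t\le h_2),\quad F(t)=1\ (t\ge h_2).$$ If moreover $1/\theta$ is not an integer $\ge2$, then $h_1=\lim_{n\in\mathcal M}(p_{n-1}+q_{n-1})\,\mu(I_n)$ and $h_2=\lim_{n\in\mathcal M}(p_{n-1}+q_{n-1}+p_{n-2}+q_{n-2})\,\mu(I_n)$. -/

import Mathlib

open Filter Topology MeasureTheory

noncomputable section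

/-- An ordered Bratteli diagram. `V n` is the set of vertices of level `n`. The edges of `E_{n+1}`
that end at `v ∈ V (n+1)` form a finite linearly ordered set; they are listed in increasing order
by `Fin (deg n v)`, and `src n v i` is the starting vertex in `V n` of the `i`-th of them. -/
structure OrderedBratteliDiagram where
  V : ℕ → Type
  deg : (n : ℕ) → V (n + 1) → ℕ
  src : (n : ℕ) → (v : V (n + 1)) → Fin (deg n v) → V n
  finite_V : ∀ n, Finite (V n)
  exists_root : ∃ v₀ : V 0, ∀ v, v = v₀
  deg_pos : ∀ n v, 0 < deg n v
  exists_out : ∀ n (u : V n), ∃ v i, src n v i = u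

namespace OrderedBratteliDiagram

/-- The edge set `E_{n+1}` between `V n` and `V (n+1)`. -/
@[ext]
structure Edge (B : OrderedBratteliDiagram) (n : ℕ) where
  tgt : B.V (n + 1)
  idx : Fin (B.deg n tgt)

variable {B : OrderedBratteliDiagram}

instance (n : ℕ) : TopologicalSpace (B.Edge n) := ⊥

/-- The starting vertex of an edge. -/
def Edge.source {n : ℕ} (e : B.Edge n) : B.V n := B.src n e.tgt e.idx

/-- No edge with the same end-point is larger. -/
def Edge.IsMaximal {n : ℕ} (e : B.Edge n) : Prop := (e.idx : ℕ) + 1 = B.deg n e.tgt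

/-- No edge with the same end-point is smaller. -/
def Edge.IsMinimal {n : ℕ} (e : B.Edge n) : Prop := (e.idx : ℕ) = 0

/-- The minimal edge ending at `v`. -/
def minEdge (n : ℕ) (v : B.V (n + 1)) : B.Edge n := ⟨v, ⟨0, B.deg_pos n v⟩⟩

/-- The successor of a non-maximal edge. -/
def Edge.succ {n : ℕ} (e : B.Edge n) (h : ¬ e.IsMaximal) : B.Edge n :=
  ⟨e.tgt, ⟨(e.idx : ℕ) + 1, lt_of_le_of_ne e.idx.isLt h⟩⟩

variable (B) in
/-- The space `X_B` of infinite paths `(e₁, e₂, …)` from the root; `x.1 n` is the edge `e_{n+1}`. -/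
def PathSpace : Type :=
  {x : (n : ℕ) → B.Edge n // ∀ n, (x n).tgt = (x (n + 1)).source}

/-- The topology generated by the cylinder sets. -/
instance : TopologicalSpace B.PathSpace :=
  inferInstanceAs (TopologicalSpace {x : (n : ℕ) → B.Edge n // ∀ n, (x n).tgt = (x (n + 1)).source})

instance : MeasurableSpace B.PathSpace := borel _

instance : BorelSpace B.PathSpace := ⟨rfl⟩

/-- The cylinder `[x₁, …, x_n]`. -/
def cylinder (x : B.PathSpace) (n : ℕ) : Set B.PathSpace := {y | ∀ i < n, y.1 i = x.1 i}

def IsMaxPath (x : B.PathSpace) : Prop := ∀ n, (x.1 n).IsMaximal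

def IsMinPath (x : B.PathSpace) : Prop := ∀ n, (x.1 n).IsMinimal

variable (B) in
/-- There are a unique maximal and a unique minimal infinite path. -/
def IsProperlyOrdered : Prop := (∃! x : B.PathSpace, IsMaxPath x) ∧ ∃! x : B.PathSpace, IsMinPath x

/-- Replace the edges with index `k - 1, k - 2, …, 0`, in this order, by the minimal edge that ends
at the starting vertex of the edge above it: the edges below index `k` become the minimal path from
the root to the starting vertex of `x k`. -/
def fillMin : ℕ → ((n : ℕ) → B.Edge n) → (n : ℕ) → B.Edge n
  | 0, x => x
  | k + 1, x => fillMin k (Function.update x k (minEdge k (x (k + 1)).source))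

theorem fillMin_compatible (k : ℕ) (x : (n : ℕ) → B.Edge n)
    (hx : ∀ n, k ≤ n → (x n).tgt = (x (n + 1)).source) (n : ℕ) :
    (fillMin k x n).tgt = (fillMin k x (n + 1)).source := by
  induction k generalizing x with
  | zero => exact hx n n.zero_le
  | succ k ih =>
    refine ih _ fun m hm => ?_
    rw [Function.update_of_ne (show m + 1 ≠ k by omega)]
    rcases hm.eq_or_lt with rfl | h
    · rw [Function.update_self]; rfl
    · rw [Function.update_of_ne h.ne']
      exact hx m h

open Classical in
/-- The Vershik map. If `k` is the least index at which the edge of `x` is not maximal, this edge is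
replaced by its successor and the edges below by the minimal path to the starting vertex of that
successor. A maximal path is sent to a minimal path (to `x_max ↦ x_min` if `B` is properly ordered;
the last branch never occurs then). -/
def vershik (x : B.PathSpace) : B.PathSpace :=
  if h : ∃ k, ¬ (x.1 k).IsMaximal then
    ⟨fillMin (Nat.find h)
        (Function.update x.1 (Nat.find h) ((x.1 (Nat.find h)).succ (Nat.find_spec h))), by
      refine fillMin_compatible _ _ fun n hn => ?_
      rw [Function.update_of_ne (show n + 1 ≠ Nat.find h by omega), ← x.2 n]
      rcases hn.eq_or_lt with rfl | h'
      · rw [Function.update_self]; rfl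
      · rw [Function.update_of_ne h'.ne']⟩
  else if h' : ∃ y : B.PathSpace, IsMinPath y then h'.choose
  else x

end OrderedBratteliDiagram

/-- The entrance time `N_I^{(1)}(x) = inf {n > 0 : Tⁿ x ∈ I}` (a set that is non-empty when the
system is minimal and `I` is open and non-empty). -/
def entranceTime {X : Type*} (T : X → X) (I : Set X) (x : X) : ℕ :=
  sInf {n : ℕ | 0 < n ∧ T^[n] x ∈ I}

/-- The distribution `F_I^{(1)}(t) = μ {x : μ(I) N_I^{(1)}(x) ≤ t}`. -/
def entranceLaw {X : Type*} [MeasurableSpace X] (μ : Measure X) (T : X → X) (I : Set X) (t : ℝ) :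
    ℝ :=
  μ.real {x | μ.real I * (entranceTime T I x : ℝ) ≤ t}

/-- The coding `I_α` of `[0,1[`: `0` (`false`) on `[0, 1 - α[` and `1` (`true`) otherwise. -/
def rotationCode (α t : ℝ) : Bool := decide (1 - α ≤ t)

/-- The Sturmian subshift `Ω_α`: the closure of the set of codings `(I_α (R_αⁿ t))_{n ∈ ℤ}`,
`t ∈ [0,1[`, where `R_αⁿ t = t + n α (mod 1)`. -/
def sturmianSubshift (α : ℝ) : Set (ℤ → Bool) :=
  closure {x | ∃ t ∈ Set.Ico (0 : ℝ) 1, x = fun n : ℤ => rotationCode α (Int.fract (t + n * α))}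

/-- The Bratteli–Vershik system of `B` is topologically conjugate to the Sturmian subshift `Ω_α`
with the shift. -/
def OrderedBratteliDiagram.RepresentsSturmian (B : OrderedBratteliDiagram) (α : ℝ) : Prop :=
  ∃ φ : B.PathSpace ≃ₜ sturmianSubshift α,
    ∀ (x : B.PathSpace) (n : ℤ), (φ (vershik x)).1 n = (φ x).1 (n + 1)

/-- The two vertices `1`, `2` of each level `n ≥ 1`. -/
inductive TwoVertices : Type
  | one
  | two

def SturmianVertex : ℕ → Type
  | 0 => Unit
  | _ + 1 => TwoVertices

/-- The number of edges that end at a vertex: one at level `1`; at level `k + 1` with `k ≥ 1` there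
are `d k + 1` at the vertex `1` and one at the vertex `2`. -/
def sturmianDeg (d : ℕ → ℕ) : (n : ℕ) → SturmianVertex (n + 1) → ℕ
  | 0, _ => 1
  | k + 1, TwoVertices.one => d (k + 1) + 1
  | _ + 1, TwoVertices.two => 1

/-- For `k ≥ 1`, of the `d k + 1` ordered edges from level `k` to the vertex `1` of level `k + 1` the
one in position `pos k` starts at the vertex `2`, and the other `d k` start at the vertex `1`; the
edge to the vertex `2` of level `k + 1` starts at the vertex `1`. -/
def sturmianSrc (d pos : ℕ → ℕ) :
    (n : ℕ) → (v : SturmianVertex (n + 1)) → Fin (sturmianDeg d n v) → SturmianVertex n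
  | 0, _, _ => ()
  | k + 1, TwoVertices.one, i => if (i : ℕ) = pos (k + 1) then TwoVertices.two else TwoVertices.one
  | _ + 1, TwoVertices.two, _ => TwoVertices.one

/-- The ordered Bratteli diagram with one edge from the root to each of the two vertices of level `1`
and, for `k ≥ 1`, incidence matrix `!![d k, 1; 1, 0]` between the levels `k` and `k + 1`, in which the
edge from the vertex `2` to the vertex `1` of the next level has position `pos k ∈ {0, …, d k}` among
the edges ending there. The value `pos k = 0` puts this edge first and `pos k = d k` puts it last. -/
def sturmianDiagram (d pos : ℕ → ℕ) (hpos : ∀ k, 1 ≤ k → pos k ≤ d k) : OrderedBratteliDiagram where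
  V := SturmianVertex
  deg := sturmianDeg d
  src := sturmianSrc d pos
  finite_V
    | 0 => inferInstanceAs (Finite Unit)
    | _ + 1 => Set.finite_univ_iff.mp <|
        (Set.toFinite {TwoVertices.one, TwoVertices.two}).subset fun v _ => by
          cases v <;> simp
  exists_root := ⟨(), fun _ => rfl⟩
  deg_pos
    | 0, _ => Nat.one_pos
    | _ + 1, TwoVertices.one => Nat.succ_pos _
    | _ + 1, TwoVertices.two => Nat.one_pos
  exists_out
    | 0, _ => ⟨TwoVertices.one, ⟨0, Nat.one_pos⟩, rfl⟩
    | _ + 1, TwoVertices.one => ⟨TwoVertices.two, ⟨0, Nat.one_pos⟩, rfl⟩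
    | k + 1, TwoVertices.two =>
        ⟨TwoVertices.one, ⟨pos (k + 1), Nat.lt_succ_of_le (hpos _ (Nat.succ_pos k))⟩, if_pos rfl⟩

/-- The terminal vertex `t(x_n)` of the `n`-th edge of a path, `n ≥ 1`. -/
def sturmianTerminal {d pos : ℕ → ℕ} {hpos : ∀ k, 1 ≤ k → pos k ≤ d k}
    (x : (sturmianDiagram d pos hpos).PathSpace) (n : ℕ) : TwoVertices :=
  (x.1 (n - 1)).tgt

/-- The numerator `p_k` of `[0 : d 1, …, d k]`. -/
def cfNum (d : ℕ → ℕ) : ℕ → ℕ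
  | 0 => 0
  | 1 => 1
  | k + 2 => d (k + 2) * cfNum d (k + 1) + cfNum d k

/-- The denominator `q_k` of `[0 : d 1, …, d k]`. -/
def cfDen (d : ℕ → ℕ) : ℕ → ℕ
  | 0 => 1
  | 1 => d 1
  | k + 2 => d (k + 2) * cfDen d (k + 1) + cfDen d k

/-- The Gauss map. -/
def gaussMap (x : ℝ) : ℝ := Int.fract (1 / x)

/-- The piecewise linear function that is `0` on `]-∞, 0]`, interpolates linearly between the points
`(0, 0)`, `(h₁, h₁)`, `(h₂, 1)`, and is `1` on `[h₂, ∞[`. -/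
def piecewiseLinearLaw (h₁ h₂ t : ℝ) : ℝ :=
  if t ≤ 0 then 0
  else if t ≤ h₁ then t
  else if t ≤ h₂ then h₁ + (1 - h₁) * (t - h₁) / (h₂ - h₁)
  else 1

end

/-!
A cylinder that ends at the vertex `1` is carried by a power of the Vershik map to the base `I` of
the Rokhlin tower over `1`, so the two sets have the same entrance law. With `p = p_{n-1} + q_{n-1}`
and `q = p_{n-2} + q_{n-2}`, the towers over the vertices `1` and `2` of level `n` have heights `p`
and `q`. An orbit never climbs the tower over `2` twice in succession, so the return time to `I` is
`p`, or `p + q` when the orbit climbs the tower over `2` in between. Kac's formula, truncated,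
`μ {0 < N ≤ m} = ∑_{j < m} μ (I \ {0 < N ≤ j})`, then says that `F_n` is up to rounding the mean of
`min (u, R)`, where `R` is the return time normalised to have mean one: it takes the values
`1 - ρ κ` and `1 + (1 - ρ) κ` with the probabilities `1 - ρ` and `ρ`, for `κ = q μ(I)` and `ρ` the
quotient of the measures of the two bases.

The measures of the bases of successive levels are the remainders of the Euclidean algorithm with
the partial quotients `d_k`, so that `ρ` is the fractional part of `1 / G^{n-2}(β)`. At an integer
value of `1 / θ` the number `ρ` need not converge and the two return times may oscillate, but the
law passes to the limit: for `ρ = 0` as well as for `ρ = 1` it is that of the constant `R = 1`.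
-/

section EntranceTime

variable {X : Type*} {T : X → X} {I D : Set X} {y : X} {j m p q : ℕ}

theorem entranceTime_eq_iff (hj : 0 < j) :
    entranceTime T I y = j ↔ T^[j] y ∈ I ∧ ∀ i, 0 < i → i < j → T^[i] y ∉ I := by
  constructor
  · rintro rfl
    exact ⟨(Nat.sInf_mem (Nat.nonempty_of_pos_sInf hj)).2,
      fun i hi hij h => Nat.notMem_of_lt_sInf hij ⟨hi, h⟩⟩
  · rintro ⟨hmem, hnot⟩
    refine le_antisymm (Nat.sInf_le ⟨hj, hmem⟩) (le_csInf ⟨j, hj, hmem⟩ fun i hi => ?_)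
    exact not_lt.1 fun hij => hnot i hi.1 hij hi.2

theorem entranceTime_mem_Icc_iff :
    entranceTime T I y ∈ Set.Icc 1 m ↔ ∃ i ∈ Set.Icc 1 m, T^[i] y ∈ I := by
  constructor
  · exact fun h => ⟨_, h, ((entranceTime_eq_iff (Set.mem_Icc.1 h).1).1 rfl).1⟩
  · rintro ⟨i, hi, hmem⟩
    have hi' : i ∈ {n : ℕ | 0 < n ∧ T^[n] y ∈ I} := ⟨hi.1, hmem⟩
    exact ⟨(Nat.sInf_mem ⟨i, hi'⟩).1, (Nat.sInf_le hi').trans hi.2⟩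

theorem entranceTime_preimage_iterate (T : X → X) (I : Set X) (j : ℕ) (y : X) :
    entranceTime T (T^[j] ⁻¹' I) y = entranceTime T I (T^[j] y) := by
  simp only [entranceTime, Set.mem_preimage, ← Function.iterate_add_apply, add_comm]

theorem entranceTime_eq_add (hm : ∀ i, 0 < i → i ≤ m → T^[i] y ∉ I)
    (hpos : 0 < entranceTime T I (T^[m] y)) :
    entranceTime T I y = m + entranceTime T I (T^[m] y) := by
  obtain ⟨hmem, hnot⟩ := (entranceTime_eq_iff hpos).1 rfl
  rw [← Function.iterate_add_apply, add_comm] at hmem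
  refine (entranceTime_eq_iff (by omega)).2 ⟨hmem, fun i hi hlt => ?_⟩
  rcases le_or_gt i m with him | him
  · exact hm i hi him
  · obtain ⟨l, rfl⟩ := Nat.exists_eq_add_of_lt him
    have := hnot (l + 1) l.succ_pos (by omega)
    rwa [← Function.iterate_add_apply, add_comm, ← add_assoc] at this

theorem preimage_entranceTime_Icc_succ (T : X → X) (I : Set X) (m : ℕ) :
    entranceTime T I ⁻¹' Set.Icc 1 (m + 1) =
      T ⁻¹' (entranceTime T I ⁻¹' Set.Icc 1 m ∪ I) := by
  ext y
  rw [Set.mem_preimage, Set.mem_preimage, Set.mem_union, Set.mem_preimage,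
    entranceTime_mem_Icc_iff, entranceTime_mem_Icc_iff]
  simp only [Set.mem_Icc]
  constructor
  · rintro ⟨_ | _ | i, hi, hmem⟩
    · omega
    · exact .inr hmem
    · exact .inl ⟨i + 1, by omega, hmem⟩
  · rintro (⟨i, hi, hmem⟩ | hmem)
    · exact ⟨i + 1, by omega, hmem⟩
    · exact ⟨1, by omega, hmem⟩

variable [MeasurableSpace X] {μ : Measure X}

theorem measurableSet_preimage_entranceTime_Icc (hT : Measurable T) (hI : MeasurableSet I) (m : ℕ) :
    MeasurableSet (entranceTime T I ⁻¹' Set.Icc 1 m) := by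
  induction m with
  | zero => simp
  | succ m ih => exact preimage_entranceTime_Icc_succ T I m ▸ hT (ih.union hI)

theorem measurable_entranceTime (hT : Measurable T) (hI : MeasurableSet I) :
    Measurable (entranceTime T I) := by
  have hK := measurableSet_preimage_entranceTime_Icc hT hI
  have hzero : entranceTime T I ⁻¹' {0} = (⋃ m, entranceTime T I ⁻¹' Set.Icc 1 m)ᶜ := by
    rw [← Set.preimage_iUnion, ← Set.preimage_compl]
    congr 1
    ext n
    simp only [Set.mem_singleton_iff, Set.mem_compl_iff, Set.mem_iUnion, Set.mem_Icc, not_exists]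
    exact ⟨fun h m => by omega, fun h => by have := h n; omega⟩
  refine measurable_to_countable' fun k => ?_
  cases k with
  | zero => exact hzero ▸ (MeasurableSet.iUnion hK).compl
  | succ k =>
    have hsucc : ({k + 1} : Set ℕ) = Set.Icc 1 (k + 1) \ Set.Icc 1 k := by
      ext n
      simp only [Set.mem_singleton_iff, Set.mem_sdiff, Set.mem_Icc]
      omega
    rw [hsucc, Set.preimage_sdiff]
    exact (hK _).diff (hK _)

theorem entranceLaw_preimage_iterate (hT : MeasurePreserving T μ μ) (hI : MeasurableSet I) (j : ℕ)
    (t : ℝ) : entranceLaw μ T (T^[j] ⁻¹' I) t = entranceLaw μ T I t := by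
  have hmeas : MeasurableSet {y | μ.real I * (entranceTime T I y : ℝ) ≤ t} :=
    measurable_entranceTime hT.measurable hI
      (.of_discrete (s := {n : ℕ | μ.real I * (n : ℝ) ≤ t}))
  simp only [entranceLaw, entranceTime_preimage_iterate,
    (hT.iterate j).measureReal_preimage hI.nullMeasurableSet]
  exact (hT.iterate j).measureReal_preimage hmeas.nullMeasurableSet

/-! ### Kac's formula for two return times -/

theorem measureReal_preimage_entranceTime_Icc [IsFiniteMeasure μ] (hT : MeasurePreserving T μ μ)
    (hI : MeasurableSet I) (m : ℕ) :
    μ.real (entranceTime T I ⁻¹' Set.Icc 1 m) =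
      ∑ j ∈ Finset.range m, μ.real (I \ entranceTime T I ⁻¹' Set.Icc 1 j) := by
  induction m with
  | zero => simp
  | succ m ih =>
    have hK := measurableSet_preimage_entranceTime_Icc hT.measurable hI m
    rw [preimage_entranceTime_Icc_succ,
      hT.measureReal_preimage (hK.union hI).nullMeasurableSet, Finset.sum_range_succ, ← ih,
      ← measureReal_union' Set.disjoint_sdiff_right hK, Set.union_sdiff_self]

theorem measureReal_sdiff_preimage_entranceTime_Icc [IsFiniteMeasure μ] (hD : MeasurableSet D)
    (hDI : D ⊆ I) (hp : 0 < p) (hshort : ∀ y ∈ I \ D, entranceTime T I y = p)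
    (hlong : ∀ y ∈ D, entranceTime T I y = p + q) (j : ℕ) :
    μ.real (I \ entranceTime T I ⁻¹' Set.Icc 1 j) =
      (if j < p then μ.real (I \ D) else 0) + if j < p + q then μ.real D else 0 := by
  have hset : I \ entranceTime T I ⁻¹' Set.Icc 1 j =
      {y ∈ I \ D | j < p} ∪ {y ∈ D | j < p + q} := by
    ext y
    by_cases hyD : y ∈ D
    · simp only [Set.mem_sdiff, Set.mem_preimage, Set.mem_Icc, hDI hyD, hlong y hyD, Set.mem_union,
        Set.mem_ofPred_eq, hyD]
      grind
    · by_cases hyI : y ∈ I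
      · simp only [Set.mem_sdiff, Set.mem_preimage, Set.mem_Icc, hyI, hshort y ⟨hyI, hyD⟩,
          Set.mem_union, Set.mem_ofPred_eq, hyD]
        grind
      · simp [hyI, hyD]
  have hdisj : Disjoint {y ∈ I \ D | j < p} {y ∈ D | j < p + q} :=
    Set.disjoint_sdiff_left.mono (Set.sep_subset _ _) (Set.sep_subset _ _)
  have hmeas : MeasurableSet {y ∈ D | j < p + q} := hD.inter (.const _)
  have hsep (A : Set X) (P : Prop) [Decidable P] :
      μ.real {y ∈ A | P} = if P then μ.real A else 0 := by
    split_ifs with hP <;> simp [hP]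
  rw [hset, measureReal_union hdisj hmeas, hsep, hsep]

theorem measureReal_preimage_entranceTime_Icc_of_two_return_times [IsFiniteMeasure μ]
    (hT : MeasurePreserving T μ μ) (hI : MeasurableSet I) (hD : MeasurableSet D) (hDI : D ⊆ I)
    (hp : 0 < p) (hshort : ∀ y ∈ I \ D, entranceTime T I y = p)
    (hlong : ∀ y ∈ D, entranceTime T I y = p + q) (m : ℕ) :
    μ.real (entranceTime T I ⁻¹' Set.Icc 1 m) =
      min (m : ℝ) p * μ.real (I \ D) + min (m : ℝ) (p + q) * μ.real D := by
  have hsum (r : ℕ) (c : ℝ) :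
      ∑ j ∈ Finset.range m, (if j < r then c else 0) = min (m : ℝ) r * c := by
    have hfilter : {j ∈ Finset.range m | j < r} = Finset.range (min m r) := by
      ext j
      simp
    rw [← Finset.sum_filter, hfilter, Finset.sum_const, Finset.card_range, nsmul_eq_mul,
      Nat.cast_min]
  simp only [measureReal_preimage_entranceTime_Icc hT hI,
    measureReal_sdiff_preimage_entranceTime_Icc hD hDI hp hshort hlong, Finset.sum_add_distrib,
    hsum, Nat.cast_add]

theorem entranceLaw_eq_measureReal (hI : 0 < μ.real I) (hN : ∀ᵐ y ∂μ, 0 < entranceTime T I y)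
    (t : ℝ) :
    entranceLaw μ T I t = μ.real (entranceTime T I ⁻¹' Set.Icc 1 ⌊t / μ.real I⌋₊) := by
  refine measureReal_congr ?_
  filter_upwards [hN] with y hy
  refine propext (Iff.trans ?_ (and_iff_right hy).symm)
  rw [Nat.le_floor_iff' hy.ne', le_div_iff₀' hI]
  exact Iff.rfl

theorem entranceLaw_of_two_return_times [IsProbabilityMeasure μ]
    (hT : MeasurePreserving T μ μ) (hI : MeasurableSet I) (hD : MeasurableSet D) (hDI : D ⊆ I)
    (hp : 0 < p) (hshort : ∀ y ∈ I \ D, entranceTime T I y = p)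
    (hlong : ∀ y ∈ D, entranceTime T I y = p + q) (hI0 : 0 < μ.real I)
    (htotal : p * μ.real (I \ D) + (p + q) * μ.real D = 1) (t : ℝ) :
    entranceLaw μ T I t =
      min (⌊t / μ.real I⌋₊ : ℝ) p * μ.real (I \ D) +
        min (⌊t / μ.real I⌋₊ : ℝ) (p + q) * μ.real D := by
  have hlaw :=
    measureReal_preimage_entranceTime_Icc_of_two_return_times hT hI hD hDI hp hshort hlong
  have hfull : μ.real (entranceTime T I ⁻¹' Set.Icc 1 (p + q)) = 1 := by
    rw [hlaw, ← htotal, Nat.cast_add, min_self, min_eq_right (by simp)]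
  have hpos : ∀ᵐ y ∂μ, 0 < entranceTime T I y := by
    have hK := measurableSet_preimage_entranceTime_Icc hT.measurable hI (p + q)
    have hae : ∀ᵐ y ∂μ, entranceTime T I y ∈ Set.Icc 1 (p + q) := by
      rw [ae_iff, ← measureReal_eq_zero_iff]
      exact (probReal_compl_eq_one_sub hK).trans (by rw [hfull, sub_self])
    exact hae.mono fun y hy => hy.1
  rw [entranceLaw_eq_measureReal hI0 hpos, hlaw]

end EntranceTime

namespace OrderedBratteliDiagram

variable {B : OrderedBratteliDiagram}

/-! ### Towers of an ordered Bratteli diagram -/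

variable (B) in
/-- The number of paths from the root to a vertex. -/
def towerHeight : (n : ℕ) → B.V n → ℕ
  | 0, _ => 1
  | n + 1, v => ∑ i : Fin (B.deg n v), towerHeight n (B.src n v i)

/-- The number of paths to the end-point of `e` whose last edge is smaller than `e`. -/
def Edge.offset {n : ℕ} (e : B.Edge n) : ℕ :=
  ∑ i ∈ Finset.Iio e.idx, B.towerHeight n (B.src n e.tgt i)

/-- The vertex of level `n` on a path. -/
def vertex (n : ℕ) (y : B.PathSpace) : B.V n := (y.1 n).source

/-- The number of predecessors of the initial segment of length `n` of a path among the paths with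
the same end-point. -/
def rank : ℕ → B.PathSpace → ℕ
  | 0, _ => 0
  | n + 1, y => rank n y + (y.1 n).offset

/-- The level `j` of the Rokhlin tower over the vertex `v` of level `n`, the base being `j = 0`. -/
def towerLevel (n : ℕ) (v : B.V n) (j : ℕ) : Set B.PathSpace :=
  {y | vertex n y = v ∧ rank n y = j}

theorem vertex_succ (n : ℕ) (y : B.PathSpace) : vertex (n + 1) y = (y.1 n).tgt := (y.2 n).symm

theorem towerHeight_pos (n : ℕ) (v : B.V n) : 0 < B.towerHeight n v := by
  induction n with
  | zero => exact Nat.one_pos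
  | succ n ih => exact Finset.sum_pos (fun i _ => ih _) ⟨⟨0, B.deg_pos n v⟩, Finset.mem_univ _⟩

namespace Edge

variable {n : ℕ} {e f : B.Edge n}

theorem offset_add_towerHeight (e : B.Edge n) :
    e.offset + B.towerHeight n e.source =
      ∑ i ∈ Finset.Iic e.idx, B.towerHeight n (B.src n e.tgt i) := by
  rw [← Finset.Iio_insert, Finset.sum_insert (by simp), add_comm]
  rfl

theorem offset_add_towerHeight_le (e : B.Edge n) :
    e.offset + B.towerHeight n e.source ≤ B.towerHeight (n + 1) e.tgt := by
  rw [e.offset_add_towerHeight]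
  exact Finset.sum_le_sum_of_subset (Finset.subset_univ _)

theorem IsMaximal.offset_add_towerHeight (h : e.IsMaximal) :
    e.offset + B.towerHeight n e.source = B.towerHeight (n + 1) e.tgt := by
  rw [e.offset_add_towerHeight]
  refine Finset.sum_congr (Finset.eq_univ_iff_forall.2 fun i => ?_) fun _ _ => rfl
  have hmax : (e.idx : ℕ) + 1 = B.deg n e.tgt := h
  rw [Finset.mem_Iic, Fin.le_def]
  omega

theorem IsMinimal.offset_eq_zero (h : e.IsMinimal) : e.offset = 0 := by
  refine Finset.sum_eq_zero fun i hi => ?_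
  have hmin : (e.idx : ℕ) = 0 := h
  rw [Finset.mem_Iio, Fin.lt_def] at hi
  omega

theorem offset_succ (e : B.Edge n) (h : ¬ e.IsMaximal) :
    (e.succ h).offset = e.offset + B.towerHeight n e.source := by
  rw [e.offset_add_towerHeight]
  obtain ⟨v, i⟩ := e
  have hi : (i : ℕ) + 1 < B.deg n v := lt_of_le_of_ne i.isLt h
  change ∑ k ∈ Finset.Iio (⟨i + 1, hi⟩ : Fin (B.deg n v)), _ = ∑ k ∈ Finset.Iic i, _
  refine Finset.sum_congr (Finset.ext fun k => ?_) fun _ _ => rfl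
  rw [Finset.mem_Iio, Finset.mem_Iic, Fin.lt_def, Fin.le_def, Nat.lt_succ_iff]

theorem succ_ne (e : B.Edge n) (h : ¬ e.IsMaximal) : e.succ h ≠ e :=
  fun heq => Nat.succ_ne_self _ (congrArg (fun f : B.Edge n => (f.idx : ℕ)) heq)

theorem offset_add_towerHeight_le_offset {v : B.V (n + 1)} {i j : Fin (B.deg n v)} (h : i < j) :
    (⟨v, i⟩ : B.Edge n).offset + B.towerHeight n (B.src n v i) ≤ (⟨v, j⟩ : B.Edge n).offset := by
  refine (offset_add_towerHeight ⟨v, i⟩).trans_le (Finset.sum_le_sum_of_subset fun k hk => ?_)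
  exact Finset.mem_Iio.2 ((Finset.mem_Iic.1 hk).trans_lt h)

theorem eq_of_add_offset_eq (htgt : e.tgt = f.tgt) {i j : ℕ}
    (hi : i < B.towerHeight n e.source) (hj : j < B.towerHeight n f.source)
    (hij : i + e.offset = j + f.offset) : e = f := by
  obtain ⟨v, k⟩ := e
  obtain ⟨v', l⟩ := f
  obtain rfl : v = v' := htgt
  simp only [source] at hi hj
  rcases lt_trichotomy k l with h | rfl | h
  · have := offset_add_towerHeight_le_offset h
    omega
  · rfl
  · have := offset_add_towerHeight_le_offset h
    omega

end Edge

section Rank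

variable {n : ℕ} {x y z : B.PathSpace}

theorem rank_lt (n : ℕ) (y : B.PathSpace) : rank n y < B.towerHeight n (vertex n y) := by
  induction n with
  | zero => exact Nat.one_pos
  | succ n ih =>
    rw [vertex_succ, rank]
    exact (Nat.add_lt_add_right ih _).trans_le
      ((Nat.add_comm _ _).trans_le (y.1 n).offset_add_towerHeight_le)

theorem rank_add_one_of_isMaximal (h : ∀ i < n, (y.1 i).IsMaximal) :
    rank n y + 1 = B.towerHeight n (vertex n y) := by
  induction n with
  | zero => rfl
  | succ n ih =>
    rw [vertex_succ, rank, ← (h n n.lt_succ_self).offset_add_towerHeight, add_right_comm,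
      ih fun i hi => h i (hi.trans n.lt_succ_self)]
    exact add_comm _ _

theorem rank_eq_zero_of_isMinimal (h : ∀ i < n, (y.1 i).IsMinimal) : rank n y = 0 := by
  induction n with
  | zero => rfl
  | succ n ih =>
    rw [rank, ih fun i hi => h i (hi.trans n.lt_succ_self), (h n n.lt_succ_self).offset_eq_zero]

theorem eq_of_rank_eq (hvertex : vertex n y = vertex n z) (hrank : rank n y = rank n z) :
    ∀ i < n, y.1 i = z.1 i := by
  induction n with
  | zero => exact fun i hi => absurd hi i.not_lt_zero
  | succ n ih =>
    rw [vertex_succ, vertex_succ] at hvertex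
    have hedge := Edge.eq_of_add_offset_eq hvertex (rank_lt n y) (rank_lt n z) hrank
    rw [rank, rank, hedge] at hrank
    intro i hi
    rcases (Nat.lt_succ_iff.1 hi).eq_or_lt with rfl | hi
    · exact hedge
    · exact ih (congrArg Edge.source hedge) (Nat.add_right_cancel hrank) i hi

theorem rank_eq_of_forall_eq (h : ∀ i < n, y.1 i = z.1 i) : rank n y = rank n z := by
  induction n with
  | zero => rfl
  | succ n ih =>
    rw [rank, rank, ih fun i hi => h i (hi.trans n.lt_succ_self), h n n.lt_succ_self]

theorem vertex_eq_of_forall_eq (h : ∀ i < n, y.1 i = z.1 i) : vertex n y = vertex n z := by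
  cases n with
  | zero =>
    obtain ⟨root, hroot⟩ := B.exists_root
    exact (hroot _).trans (hroot _).symm
  | succ n => rw [vertex_succ, vertex_succ, h n n.lt_succ_self]

theorem cylinder_eq_towerLevel (x : B.PathSpace) (n : ℕ) :
    cylinder x n = towerLevel n (vertex n x) (rank n x) :=
  Set.ext fun _ =>
    ⟨fun h => ⟨vertex_eq_of_forall_eq h, rank_eq_of_forall_eq h⟩, fun h => eq_of_rank_eq h.1 h.2⟩

theorem towerLevel_zero_of_unique_edge {u : B.V n} {e : B.Edge n}
    (he : ∀ f : B.Edge n, f.source = u ↔ f = e) :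
    towerLevel n u 0 = towerLevel (n + 1) e.tgt e.offset := by
  ext y
  constructor
  · rintro ⟨hvertex, hrank⟩
    rw [← (he _).1 hvertex]
    exact ⟨vertex_succ n y, by rw [rank, hrank, zero_add]⟩
  · rintro ⟨hvertex, hrank⟩
    rw [vertex_succ] at hvertex
    obtain rfl := Edge.eq_of_add_offset_eq hvertex (rank_lt n y) (towerHeight_pos n _)
      (hrank.trans (zero_add _).symm)
    exact ⟨(he _).2 rfl, Nat.add_eq_right.1 hrank⟩

end Rank

/-! ### The Vershik map on the towers -/

section Vershik

open CategoryTheory Opposite in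
theorem exists_isMinPath (B : OrderedBratteliDiagram) : ∃ y : B.PathSpace, IsMinPath y := by
  have hfinite := B.finite_V
  have hnonempty (n : ℕ) : Nonempty (B.V n) := by
    induction n with
    | zero => exact B.exists_root.nonempty
    | succ n ih => exact ih.elim fun u => (B.exists_out n u).nonempty
  let F : ℕᵒᵖ ⥤ Type :=
    Functor.ofOpSequence (X := B.V) fun n => ↾fun v : B.V (n + 1) => (minEdge n v).source
  have hF (n : ℕᵒᵖ) : F.obj n = B.V n.unop := rfl
  have (n : ℕᵒᵖ) : Finite (F.obj n) := hF n ▸ hfinite _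
  have (n : ℕᵒᵖ) : Nonempty (F.obj n) := hF n ▸ hnonempty _
  obtain ⟨v, hv⟩ := nonempty_sections_of_finite_inverse_system F
  have hsource (n : ℕ) : (minEdge n (v (op (n + 1)))).source = v (op n) := by
    have h := hv (homOfLE (Nat.le_add_right n 1)).op
    rwa [Functor.ofOpSequence_map_homOfLE_succ] at h
  exact ⟨⟨fun n => minEdge n (v (op (n + 1))), fun n => (hsource (n + 1)).symm⟩, fun _ => rfl⟩

variable {n : ℕ} {v : B.V n} {j : ℕ} {y : B.PathSpace}

theorem fillMin_of_le {k n : ℕ} (h : k ≤ n) (x : (n : ℕ) → B.Edge n) : fillMin k x n = x n := by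
  induction k generalizing x with
  | zero => rfl
  | succ k ih =>
    rw [fillMin, ih (by omega), Function.update_of_ne (by omega)]

theorem isMinimal_fillMin {k n : ℕ} (h : n < k) (x : (n : ℕ) → B.Edge n) :
    (fillMin k x n).IsMinimal := by
  induction k generalizing x with
  | zero => exact absurd h n.not_lt_zero
  | succ k ih =>
    rcases (Nat.lt_succ_iff.1 h).eq_or_lt with rfl | h
    · rw [fillMin, fillMin_of_le le_rfl, Function.update_self]
      rfl
    · exact ih h _

theorem vershik_cases (y : B.PathSpace) :
    (∃ k, ∃ h : ¬ (y.1 k).IsMaximal, (∀ i < k, (y.1 i).IsMaximal ∧ ((vershik y).1 i).IsMinimal) ∧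
      (vershik y).1 k = (y.1 k).succ h ∧ ∀ i, k < i → (vershik y).1 i = y.1 i) ∨
    ∀ i, (y.1 i).IsMaximal ∧ ((vershik y).1 i).IsMinimal := by
  classical
  by_cases h : ∃ k, ¬ (y.1 k).IsMaximal
  · have hval : (vershik y).1 = fillMin (Nat.find h)
        (Function.update y.1 (Nat.find h) ((y.1 (Nat.find h)).succ (Nat.find_spec h))) :=
      congrArg Subtype.val (dif_pos h)
    refine .inl ⟨Nat.find h, Nat.find_spec h, fun i hi => ⟨not_not.1 (Nat.find_min h hi), ?_⟩, ?_,
      fun i hi => ?_⟩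
    · rw [hval]
      exact isMinimal_fillMin hi _
    · rw [hval, fillMin_of_le le_rfl, Function.update_self]
    · rw [hval, fillMin_of_le hi.le, Function.update_of_ne hi.ne']
  · have hval : vershik y = B.exists_isMinPath.choose :=
      (dif_neg h).trans (dif_pos B.exists_isMinPath)
    exact .inr fun i => ⟨by_contra fun hi => h ⟨i, hi⟩, hval ▸ B.exists_isMinPath.choose_spec i⟩

theorem vershik_edge_cases_of_isMaximal (h : ∀ i < n, (y.1 i).IsMaximal) :
    (∃ hn : ¬ (y.1 n).IsMaximal, (vershik y).1 n = (y.1 n).succ hn) ∨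
      (y.1 n).IsMaximal ∧ ((vershik y).1 n).IsMinimal := by
  rcases vershik_cases y with ⟨k, hk, hbelow, hsucc, -⟩ | hmax
  · rcases (not_lt.1 fun hkn => hk (h k hkn)).eq_or_lt with rfl | hnk
    · exact .inl ⟨hk, hsucc⟩
    · exact .inr (hbelow n hnk)
  · exact .inr (hmax n)

theorem vertex_rank_vershik_cases (n : ℕ) (y : B.PathSpace) :
    (vertex n (vershik y) = vertex n y ∧ rank n (vershik y) = rank n y + 1) ∨
    ∀ i < n, (y.1 i).IsMaximal ∧ ((vershik y).1 i).IsMinimal := by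
  rcases vershik_cases y with ⟨k, hk, hbelow, hsucc, habove⟩ | hmax
  · rcases lt_or_ge k n with hkn | hnk
    · refine .inl ⟨congrArg Edge.source (habove n hkn), ?_⟩
      induction n, hkn using Nat.le_induction with
      | base =>
        rw [Nat.succ_eq_add_one, rank, rank, hsucc, Edge.offset_succ,
          rank_eq_zero_of_isMinimal fun i hi => (hbelow i hi).2, zero_add, add_right_comm,
          rank_add_one_of_isMaximal fun i hi => (hbelow i hi).1]
        exact add_comm _ _
      | succ m hm ih => rw [rank, rank, ih, habove m hm, add_right_comm]
    · exact .inr fun i hi => hbelow i (hi.trans_le hnk)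
  · exact .inr fun i _ => hmax i

theorem vertex_rank_vershik (h : rank n y + 1 < B.towerHeight n (vertex n y)) :
    vertex n (vershik y) = vertex n y ∧ rank n (vershik y) = rank n y + 1 :=
  (vertex_rank_vershik_cases n y).resolve_right fun hmax =>
    h.ne (rank_add_one_of_isMaximal fun i hi => (hmax i hi).1)

theorem isMaximal_of_rank_vershik_eq_zero (h : rank n (vershik y) = 0) :
    ∀ i < n, (y.1 i).IsMaximal :=
  fun i hi => ((vertex_rank_vershik_cases n y).resolve_left (by omega) i hi).1

theorem rank_vershik_eq_zero_iff :
    rank n (vershik y) = 0 ↔ rank n y + 1 = B.towerHeight n (vertex n y) := by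
  refine ⟨fun h => rank_add_one_of_isMaximal (isMaximal_of_rank_vershik_eq_zero h), fun h => ?_⟩
  rcases vertex_rank_vershik_cases n y with ⟨hvertex, hrank⟩ | hmin
  · have := rank_lt n (vershik y)
    rw [hvertex, hrank] at this
    omega
  · exact rank_eq_zero_of_isMinimal fun i hi => (hmin i hi).2

theorem preimage_vershik_towerLevel (hj : j + 1 < B.towerHeight n v) :
    vershik ⁻¹' towerLevel n v (j + 1) = towerLevel n v j := by
  ext y
  constructor
  · rintro ⟨hvertex, hrank⟩
    rcases vertex_rank_vershik_cases n y with h | h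
    · exact ⟨h.1.symm.trans hvertex, Nat.add_right_cancel (h.2.symm.trans hrank)⟩
    · have := rank_eq_zero_of_isMinimal fun i hi => (h i hi).2
      omega
  · rintro ⟨rfl, rfl⟩
    exact vertex_rank_vershik hj

theorem preimage_iterate_vershik_towerLevel (hj : j < B.towerHeight n v) :
    vershik^[j] ⁻¹' towerLevel n v j = towerLevel n v 0 := by
  induction j with
  | zero => rfl
  | succ j ih =>
    rw [Function.iterate_succ', Set.preimage_comp, preimage_vershik_towerLevel hj, ih (by omega)]

theorem iterate_vershik_mem_towerLevel (hy : y ∈ towerLevel n v 0) (hj : j < B.towerHeight n v) :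
    vershik^[j] y ∈ towerLevel n v j := by
  rwa [← preimage_iterate_vershik_towerLevel hj] at hy

theorem rank_iterate_vershik_towerHeight (hy : y ∈ towerLevel n v 0) :
    rank n (vershik^[B.towerHeight n v] y) = 0 := by
  obtain ⟨m, hm⟩ := Nat.exists_eq_add_one.2 (towerHeight_pos n v)
  obtain ⟨hvertex, hrank⟩ := iterate_vershik_mem_towerLevel (j := m) hy (by omega)
  rw [hm, Function.iterate_succ_apply', rank_vershik_eq_zero_iff, hvertex, hrank, hm]

theorem entranceTime_towerLevel_zero {u : B.V n} (hy : y ∈ towerLevel n u 0)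
    (hreturn : vershik^[B.towerHeight n u] y ∈ towerLevel n v 0) :
    entranceTime vershik (towerLevel n v 0) y = B.towerHeight n u := by
  refine (entranceTime_eq_iff (towerHeight_pos n u)).2 ⟨hreturn, fun i hi hlt hmem => ?_⟩
  exact hi.ne' ((iterate_vershik_mem_towerLevel hy hlt).2.symm.trans hmem.2)

end Vershik

section Measure

theorem continuous_edge (n : ℕ) : Continuous fun y : B.PathSpace => y.1 n :=
  (continuous_apply n).comp continuous_subtype_val

instance (n : ℕ) : DiscreteTopology (B.Edge n) := ⟨rfl⟩

theorem continuous_rank (n : ℕ) : Continuous (rank n : B.PathSpace → ℕ) := by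
  induction n with
  | zero => exact continuous_const
  | succ n ih =>
    exact ih.add ((continuous_of_discreteTopology (f := Edge.offset)).comp (continuous_edge n))

theorem measurableSet_vertex_eq (n : ℕ) (v : B.V n) : MeasurableSet {y | vertex n y = v} :=
  ((isOpen_discrete {e : B.Edge n | e.source = v}).preimage (continuous_edge n)).measurableSet

theorem measurableSet_towerLevel (n : ℕ) (v : B.V n) (j : ℕ) :
    MeasurableSet (towerLevel n v j) :=
  (measurableSet_vertex_eq n v).inter
    ((isOpen_discrete {j}).preimage (continuous_rank n)).measurableSet

variable {μ : Measure B.PathSpace} {n : ℕ} {v w : B.V n}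

theorem measureReal_towerLevel (hμ : MeasurePreserving vershik μ μ) {j : ℕ}
    (hj : j < B.towerHeight n v) : μ.real (towerLevel n v j) = μ.real (towerLevel n v 0) := by
  rw [← preimage_iterate_vershik_towerLevel hj]
  exact ((hμ.iterate j).measureReal_preimage
    (measurableSet_towerLevel n v j).nullMeasurableSet).symm

theorem measureReal_towerLevel_of_unique_edge (hμ : MeasurePreserving vershik μ μ) {e : B.Edge n}
    (he : ∀ f : B.Edge n, f.source = v ↔ f = e) :
    μ.real (towerLevel n v 0) = μ.real (towerLevel (n + 1) e.tgt 0) := by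
  rw [towerLevel_zero_of_unique_edge he, measureReal_towerLevel hμ]
  exact (Nat.lt_add_of_pos_right (towerHeight_pos n _)).trans_le e.offset_add_towerHeight_le

theorem measureReal_cylinder (hμ : MeasurePreserving vershik μ μ) (x : B.PathSpace) (n : ℕ) :
    μ.real (cylinder x n) = μ.real (towerLevel n (vertex n x) 0) := by
  rw [cylinder_eq_towerLevel, measureReal_towerLevel hμ (rank_lt n x)]

theorem measureReal_vertex_eq [IsFiniteMeasure μ] (hμ : MeasurePreserving vershik μ μ) (n : ℕ)
    (v : B.V n) :
    μ.real {y | vertex n y = v} = B.towerHeight n v * μ.real (towerLevel n v 0) := by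
  have hlevels : {y | vertex n y = v} =
      ⋃ j ∈ Finset.range (B.towerHeight n v), towerLevel n v j := by
    ext y
    simp only [Set.mem_iUnion, Finset.mem_range, exists_prop]
    refine ⟨?_, fun ⟨_, _, hj⟩ => hj.1⟩
    rintro rfl
    exact ⟨_, rank_lt n y, rfl, rfl⟩
  rw [hlevels, measureReal_biUnion_finset
      (fun i _ j _ hij => Set.disjoint_left.2 fun _ hi hj => hij (hi.2.symm.trans hj.2))
      fun j _ => measurableSet_towerLevel n v j,
    Finset.sum_congr rfl fun j hj => measureReal_towerLevel hμ (Finset.mem_range.1 hj),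
    Finset.sum_const, Finset.card_range, nsmul_eq_mul]

theorem entranceLaw_cylinder (hμ : MeasurePreserving vershik μ μ) (x : B.PathSpace) (n : ℕ)
    (t : ℝ) :
    entranceLaw μ vershik (cylinder x n) t =
      entranceLaw μ vershik (towerLevel n (vertex n x) 0) t := by
  rw [cylinder_eq_towerLevel, ← preimage_iterate_vershik_towerLevel (rank_lt n x),
    entranceLaw_preimage_iterate hμ (measurableSet_towerLevel n _ _)]

theorem total_mass_of_two_towers [IsProbabilityMeasure μ] (hμ : MeasurePreserving vershik μ μ)
    (hvw : ∀ u, u ≠ v ↔ u = w) :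
    B.towerHeight n v * μ.real (towerLevel n v 0) +
      B.towerHeight n w * μ.real (towerLevel n w 0) = 1 := by
  have hcompl : {y : B.PathSpace | vertex n y = w} = {y | vertex n y = v}ᶜ :=
    Set.ext fun y => (hvw _).symm
  rw [← measureReal_vertex_eq hμ, ← measureReal_vertex_eq hμ, hcompl,
    probReal_add_probReal_compl (measurableSet_vertex_eq n v)]

end Measure

/-! ### Return times when there are only two towers -/

section TwoTowers

variable {n : ℕ} {v w : B.V n} {y : B.PathSpace}

theorem preimage_iterate_vershik_subset_towerLevel
    (hww : vershik ⁻¹' towerLevel n w 0 ⊆ towerLevel n v (B.towerHeight n v - 1)) :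
    vershik^[B.towerHeight n v] ⁻¹' towerLevel n w 0 ⊆ towerLevel n v 0 := by
  obtain ⟨m, hm⟩ := Nat.exists_eq_add_one.2 (towerHeight_pos n v)
  rw [hm, Nat.add_sub_cancel] at hww
  rw [hm, Function.iterate_succ', Set.preimage_comp,
    ← preimage_iterate_vershik_towerLevel (v := v) (j := m) (by omega)]
  exact Set.preimage_mono hww

theorem entranceTime_of_iterate_notMem (hvw : ∀ u, u ≠ v ↔ u = w) (hy : y ∈ towerLevel n v 0)
    (hnot : vershik^[B.towerHeight n v] y ∉ towerLevel n w 0) :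
    entranceTime vershik (towerLevel n v 0) y = B.towerHeight n v := by
  have hrank := rank_iterate_vershik_towerHeight hy
  exact entranceTime_towerLevel_zero hy
    ⟨by_contra fun hv => hnot ⟨(hvw _).1 hv, hrank⟩, hrank⟩

theorem iterate_vershik_mem_of_preimage_subset (hvw : ∀ u, u ≠ v ↔ u = w)
    (hww : vershik ⁻¹' towerLevel n w 0 ⊆ {y | vertex n y = v}) (hy : y ∈ towerLevel n w 0) :
    vershik^[B.towerHeight n w] y ∈ towerLevel n v 0 := by
  have hrank := rank_iterate_vershik_towerHeight hy
  obtain ⟨m, hm⟩ := Nat.exists_eq_add_one.2 (towerHeight_pos n w)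
  refine ⟨by_contra fun hv => ?_, hrank⟩
  have hw : vershik^[B.towerHeight n w] y ∈ towerLevel n w 0 := ⟨(hvw _).1 hv, hrank⟩
  rw [hm, Function.iterate_succ_apply'] at hw
  exact (hvw w).2 rfl
    ((iterate_vershik_mem_towerLevel (j := m) hy (by omega)).1.symm.trans (hww hw))

theorem entranceTime_of_iterate_mem (hvw : ∀ u, u ≠ v ↔ u = w)
    (hww : vershik ⁻¹' towerLevel n w 0 ⊆ {y | vertex n y = v}) (hy : y ∈ towerLevel n v 0)
    (hmem : vershik^[B.towerHeight n v] y ∈ towerLevel n w 0) :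
    entranceTime vershik (towerLevel n v 0) y = B.towerHeight n v + B.towerHeight n w := by
  have hsecond := entranceTime_towerLevel_zero hmem
    (iterate_vershik_mem_of_preimage_subset hvw hww hmem)
  rw [entranceTime_eq_add (fun i hi hle hmem' => ?_) (hsecond ▸ towerHeight_pos n w), hsecond]
  rcases hle.eq_or_lt with rfl | hlt
  · exact (hvw w).2 rfl (hmem.1.symm.trans hmem'.1)
  · exact hi.ne' ((iterate_vershik_mem_towerLevel hy hlt).2.symm.trans hmem'.2)

theorem entranceLaw_towerLevel_zero {μ : Measure B.PathSpace} [IsProbabilityMeasure μ]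
    (hμ : MeasurePreserving vershik μ μ) (hvw : ∀ u, u ≠ v ↔ u = w)
    (hww : vershik ⁻¹' towerLevel n w 0 ⊆ towerLevel n v (B.towerHeight n v - 1))
    (hv : 0 < μ.real (towerLevel n v 0)) (t : ℝ) :
    entranceLaw μ vershik (towerLevel n v 0) t =
      min (⌊t / μ.real (towerLevel n v 0)⌋₊ : ℝ) (B.towerHeight n v) *
          (μ.real (towerLevel n v 0) - μ.real (towerLevel n w 0)) +
        min (⌊t / μ.real (towerLevel n v 0)⌋₊ : ℝ) (B.towerHeight n v + B.towerHeight n w) *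
          μ.real (towerLevel n w 0) := by
  set D := vershik^[B.towerHeight n v] ⁻¹' towerLevel n w 0
  have hmeas := measurableSet_towerLevel n w 0
  have hD : MeasurableSet D := (hμ.iterate _).measurable hmeas
  have hDsub : D ⊆ towerLevel n v 0 := preimage_iterate_vershik_subset_towerLevel hww
  have hDreal : μ.real D = μ.real (towerLevel n w 0) :=
    (hμ.iterate _).measureReal_preimage hmeas.nullMeasurableSet
  have hdiff : μ.real (towerLevel n v 0 \ D) =
      μ.real (towerLevel n v 0) - μ.real (towerLevel n w 0) := by
    rw [measureReal_sdiff hDsub hD, hDreal]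
  have htotal := total_mass_of_two_towers hμ hvw
  rw [entranceLaw_of_two_return_times hμ (measurableSet_towerLevel n v 0) hD hDsub
    (towerHeight_pos n v) (fun y hy => entranceTime_of_iterate_notMem hvw hy.1 hy.2)
    (fun y hy => entranceTime_of_iterate_mem hvw (fun z hz => (hww hz).1) (hDsub hy) hy) hv
    (by rw [hdiff, hDreal]; linarith), hdiff, hDreal]

end TwoTowers

end OrderedBratteliDiagram

open OrderedBratteliDiagram

/-! ### The Sturmian diagram -/

section SturmianTowers

/-- The sum `p_k + q_k`, which is the height of the tower over the vertex `1` of level `k + 1`. -/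
def cfSum (d : ℕ → ℕ) (k : ℕ) : ℕ := cfNum d k + cfDen d k

theorem cfSum_add_two (d : ℕ → ℕ) (k : ℕ) :
    cfSum d (k + 2) = d (k + 2) * cfSum d (k + 1) + cfSum d k := by
  simp only [cfSum, cfNum, cfDen]
  ring

theorem sum_ite_val_eq {M : Type*} [AddCommMonoid M] {D p : ℕ} (hp : p ≤ D) (a b : M) :
    ∑ i : Fin (D + 1), (if (i : ℕ) = p then a else b) = D • b + a := by
  rw [Fintype.sum_eq_add_sum_compl (⟨p, Nat.lt_succ_of_le hp⟩ : Fin (D + 1)), if_pos rfl,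
    Finset.sum_congr rfl fun i hi => if_neg fun h =>
      Finset.notMem_singleton.1 (Finset.mem_compl.1 hi) (Fin.ext h),
    Finset.sum_const, Finset.card_compl, Fintype.card_fin, Finset.card_singleton,
    Nat.add_sub_cancel, add_comm]

variable {d pos : ℕ → ℕ} {hpos : ∀ k, 1 ≤ k → pos k ≤ d k}

variable (d pos hpos) in
theorem sturmian_towerHeight_one_succ (k : ℕ) :
    (sturmianDiagram d pos hpos).towerHeight (k + 2) TwoVertices.one =
      d (k + 1) * (sturmianDiagram d pos hpos).towerHeight (k + 1) TwoVertices.one +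
        (sturmianDiagram d pos hpos).towerHeight (k + 1) TwoVertices.two := by
  rw [← smul_eq_mul, ← sum_ite_val_eq (hpos (k + 1) k.succ_pos)]
  exact Finset.sum_congr rfl fun i _ => apply_ite _ _ _ _

variable (d pos hpos) in
theorem sturmian_towerHeight_two_succ (k : ℕ) :
    (sturmianDiagram d pos hpos).towerHeight (k + 2) TwoVertices.two =
      (sturmianDiagram d pos hpos).towerHeight (k + 1) TwoVertices.one :=
  Fin.sum_univ_one _

variable (d pos hpos) in
theorem sturmian_towerHeight_level_one (v : TwoVertices) :
    (sturmianDiagram d pos hpos).towerHeight 1 v = 1 :=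
  Fin.sum_univ_one _

variable (d pos hpos) in
theorem sturmian_towerHeight_one (k : ℕ) :
    (sturmianDiagram d pos hpos).towerHeight (k + 1) TwoVertices.one = cfSum d k := by
  induction k using Nat.twoStepInduction with
  | zero => exact sturmian_towerHeight_level_one d pos hpos _
  | one =>
    refine (sturmian_towerHeight_one_succ d pos hpos 0).trans ?_
    refine (congrArg₂ (fun a b => d 1 * a + b) (sturmian_towerHeight_level_one d pos hpos _)
      (sturmian_towerHeight_level_one d pos hpos _)).trans ?_
    simp only [cfSum, cfNum, cfDen]
    ring
  | more k h₁ h₂ =>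
    rw [sturmian_towerHeight_one_succ, h₂, sturmian_towerHeight_two_succ, h₁, cfSum_add_two]

variable (d pos hpos) in
theorem sturmian_towerHeight_two (k : ℕ) :
    (sturmianDiagram d pos hpos).towerHeight (k + 2) TwoVertices.two = cfSum d k := by
  rw [sturmian_towerHeight_two_succ, sturmian_towerHeight_one]

theorem TwoVertices.ne_one_iff (v : TwoVertices) : v ≠ one ↔ v = two := by
  cases v <;> simp

theorem sturmian_source_eq_two_iff {k : ℕ} (e : (sturmianDiagram d pos hpos).Edge (k + 1)) :
    e.source = TwoVertices.two ↔
      e = ⟨TwoVertices.one, ⟨pos (k + 1), Nat.lt_succ_of_le (hpos _ k.succ_pos)⟩⟩ := by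
  refine ⟨fun h => ?_, fun h => h ▸ if_pos rfl⟩
  rcases e with ⟨_ | _, i⟩
  · refine congrArg (Edge.mk _) (Fin.ext (by_contra fun hi => ?_))
    exact TwoVertices.noConfusion ((if_neg hi).symm.trans h)
  · exact TwoVertices.noConfusion h

theorem preimage_vershik_towerLevel_two_subset {k : ℕ} (hd : 1 ≤ d (k + 1)) :
    vershik ⁻¹' towerLevel (B := sturmianDiagram d pos hpos) (k + 1) TwoVertices.two 0 ⊆
      towerLevel (k + 1) TwoVertices.one
        ((sturmianDiagram d pos hpos).towerHeight (k + 1) TwoVertices.one - 1) := by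
  rintro z ⟨hvertex, hrank⟩
  have hone : vertex (k + 1) z = TwoVertices.one := by
    by_contra hne
    have hz := (sturmian_source_eq_two_iff _).1 ((TwoVertices.ne_one_iff _).1 hne)
    have hz' := (sturmian_source_eq_two_iff _).1 hvertex
    rcases vershik_edge_cases_of_isMaximal (isMaximal_of_rank_vershik_eq_zero hrank) with
      ⟨hn, hsucc⟩ | ⟨hmax, hmin⟩
    · exact Edge.succ_ne _ hn (hsucc.symm.trans (hz'.trans hz.symm))
    · rw [hz] at hmax
      rw [hz'] at hmin
      have hpos0 : pos (k + 1) = 0 := hmin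
      have hposd : pos (k + 1) + 1 = d (k + 1) + 1 := hmax
      omega
  exact ⟨hone, by rw [← hone, ← rank_vershik_eq_zero_iff.1 hrank, Nat.add_sub_cancel]⟩

/-- The measure of a cylinder of length `k + 1` that ends at the vertex `1`. -/
def sturmianMass (μ : Measure (sturmianDiagram d pos hpos).PathSpace) (k : ℕ) : ℝ :=
  μ.real (towerLevel (B := sturmianDiagram d pos hpos) (k + 1) TwoVertices.one 0)

variable {μ : Measure (sturmianDiagram d pos hpos).PathSpace}

theorem measureReal_towerLevel_two (hμ : MeasurePreserving vershik μ μ) (k : ℕ) :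
    μ.real (towerLevel (B := sturmianDiagram d pos hpos) (k + 1) TwoVertices.two 0) =
      sturmianMass μ (k + 1) :=
  measureReal_towerLevel_of_unique_edge hμ sturmian_source_eq_two_iff

variable [IsProbabilityMeasure μ]

theorem sturmianMass_total (hμ : MeasurePreserving vershik μ μ) (k : ℕ) :
    (sturmianDiagram d pos hpos).towerHeight (k + 1) TwoVertices.one * sturmianMass μ k +
      (sturmianDiagram d pos hpos).towerHeight (k + 1) TwoVertices.two * sturmianMass μ (k + 1) =
        1 := by
  rw [← measureReal_towerLevel_two hμ]
  exact total_mass_of_two_towers hμ TwoVertices.ne_one_iff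

theorem cfSum_mul_sturmianMass (hμ : MeasurePreserving vershik μ μ) (k : ℕ) :
    cfSum d (k + 1) * sturmianMass μ (k + 1) + cfSum d k * sturmianMass μ (k + 2) = 1 := by
  have htotal := sturmianMass_total hμ (k + 1)
  rwa [sturmian_towerHeight_one, sturmian_towerHeight_two] at htotal

theorem sturmianMass_eq (hμ : MeasurePreserving vershik μ μ) (k : ℕ) :
    sturmianMass μ k = d (k + 1) * sturmianMass μ (k + 1) + sturmianMass μ (k + 2) := by
  have hheight : ((sturmianDiagram d pos hpos).towerHeight (k + 1) TwoVertices.one : ℝ) ≠ 0 :=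
    Nat.cast_ne_zero.2 (towerHeight_pos _ _).ne'
  have hlow := sturmianMass_total hμ k
  have hhigh := sturmianMass_total hμ (k + 1)
  rw [sturmian_towerHeight_one_succ, sturmian_towerHeight_two_succ, Nat.cast_add,
    Nat.cast_mul] at hhigh
  apply mul_left_cancel₀ hheight
  linear_combination hlow - hhigh

end SturmianTowers

/-! ### Continued fractions -/

section ContinuedFraction

variable {d : ℕ → ℕ}

theorem cfDen_pos (hd : ∀ k, 1 ≤ k → 1 ≤ d k) (k : ℕ) : 0 < cfDen d k := by
  induction k using Nat.twoStepInduction with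
  | zero => exact Nat.one_pos
  | one => exact hd 1 le_rfl
  | more k h _ => exact h.trans_le (Nat.le_add_left _ _)

theorem cfSum_pos (hd : ∀ k, 1 ≤ k → 1 ≤ d k) (k : ℕ) : 0 < cfSum d k :=
  Nat.add_pos_right _ (cfDen_pos hd k)

theorem tendsto_cfSum_div_cfDen (hd : ∀ k, 1 ≤ k → 1 ≤ d k) {β : ℝ}
    (hβ : Tendsto (fun k => (cfNum d k : ℝ) / cfDen d k) atTop (𝓝 β)) :
    Tendsto (fun k => (cfSum d k : ℝ) / cfDen d k) atTop (𝓝 (β + 1)) := by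
  refine (hβ.add_const 1).congr fun k => ?_
  rw [div_add_one (Nat.cast_ne_zero.2 (cfDen_pos hd k).ne'), cfSum, Nat.cast_add]

theorem tendsto_cfSum_div_cfSum (hd : ∀ k, 1 ≤ k → 1 ≤ d k) {β w : ℝ}
    (hβ : Tendsto (fun k => (cfNum d k : ℝ) / cfDen d k) atTop (𝓝 β)) {ι : Type*} {L : Filter ι}
    {f g : ι → ℕ} (hf : Tendsto f L atTop) (hg : Tendsto g L atTop)
    (hw : Tendsto (fun n => (cfDen d (f n) : ℝ) / cfDen d (g n)) L (𝓝 w)) :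
    Tendsto (fun n => (cfSum d (f n) : ℝ) / cfSum d (g n)) L (𝓝 w) := by
  have hβ0 : 0 ≤ β := ge_of_tendsto' hβ fun k => by positivity
  have hlim := tendsto_cfSum_div_cfDen hd hβ
  have hratio := hw.mul ((hlim.comp hf).div (hlim.comp hg) (by positivity))
  rw [div_self (by positivity), mul_one] at hratio
  refine hratio.congr fun n => ?_
  have hfn : (cfDen d (f n) : ℝ) ≠ 0 := Nat.cast_ne_zero.2 (cfDen_pos hd _).ne'
  have hgn : (cfDen d (g n) : ℝ) ≠ 0 := Nat.cast_ne_zero.2 (cfDen_pos hd _).ne'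
  have hsum : (cfSum d (g n) : ℝ) ≠ 0 := Nat.cast_ne_zero.2 (cfSum_pos hd _).ne'
  simp only [Pi.div_apply, Function.comp_apply]
  field_simp

/-- `a` is a sequence of remainders of the Euclidean algorithm that does not terminate and has the
partial quotients `d 1, d 2, …`. -/
structure IsRemainderSequence (d : ℕ → ℕ) (a : ℕ → ℝ) : Prop where
  pos : ∀ k, 0 < a k
  strictAnti : StrictAnti a
  eq_add : ∀ k, a k = d (k + 1) * a (k + 1) + a (k + 2)

namespace IsRemainderSequence

variable {a : ℕ → ℝ}

theorem one_le_quotient (h : IsRemainderSequence d a) {k : ℕ} (hk : 1 ≤ k) : 1 ≤ d k := by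
  obtain ⟨k, rfl⟩ := Nat.exists_eq_add_of_le' hk
  refine Nat.one_le_iff_ne_zero.2 fun hzero => ?_
  have hle := h.eq_add k
  rw [hzero, Nat.cast_zero, zero_mul, zero_add] at hle
  exact (h.strictAnti (by omega : k < k + 2)).ne' hle

theorem tendsto_zero (h : IsRemainderSequence d a) : Tendsto a atTop (𝓝 0) := by
  have hbdd : BddBelow (Set.range a) := ⟨0, Set.forall_mem_range.2 fun k => (h.pos k).le⟩
  have hlim := tendsto_atTop_ciInf h.strictAnti.antitone hbdd
  have hnonneg : 0 ≤ ⨅ k, a k := le_ciInf fun k => (h.pos k).le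
  have hstep (k : ℕ) : a (k + 1) + a (k + 2) ≤ a k := by
    have hd : (1 : ℝ) ≤ d (k + 1) := Nat.one_le_cast.2 (h.one_le_quotient k.succ_pos)
    rw [h.eq_add k]
    exact add_le_add_left (le_mul_of_one_le_left (h.pos _).le hd) _
  have hdouble := le_of_tendsto_of_tendsto'
    (((tendsto_add_atTop_iff_nat 1).2 hlim).add ((tendsto_add_atTop_iff_nat 2).2 hlim)) hlim hstep
  rwa [show ⨅ k, a k = 0 by linarith] at hlim

theorem cfDen_mul_sub_cfNum_mul (h : IsRemainderSequence d a) (k : ℕ) :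
    cfDen d k * a 1 - cfNum d k * a 0 = (-1) ^ k * a (k + 1) := by
  induction k using Nat.twoStepInduction with
  | zero => simp [cfDen, cfNum]
  | one =>
    have hstep := h.eq_add 0
    simp only [cfDen, cfNum, zero_add] at hstep ⊢
    push_cast
    linarith
  | more k ih₁ ih₂ =>
    simp only [cfDen, cfNum]
    push_cast
    linear_combination d (k + 2) * ih₂ + ih₁ + (-1) ^ k * h.eq_add (k + 1)

theorem tendsto_convergents (h : IsRemainderSequence d a) :
    Tendsto (fun k => (cfNum d k : ℝ) / cfDen d k) atTop (𝓝 (a 1 / a 0)) := by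
  have hlim := ((tendsto_add_atTop_iff_nat 1).2 h.tendsto_zero).div_const (a 0)
  rw [zero_div] at hlim
  refine tendsto_iff_dist_tendsto_zero.2 (squeeze_zero (fun _ => dist_nonneg) (fun k => ?_) hlim)
  have hden : (1 : ℝ) ≤ cfDen d k :=
    Nat.one_le_cast.2 (cfDen_pos (fun _ => h.one_le_quotient) k)
  have hdiff : a 1 / a 0 - cfNum d k / cfDen d k = (-1) ^ k * a (k + 1) / (a 0 * cfDen d k) := by
    rw [← h.cfDen_mul_sub_cfNum_mul, div_sub_div _ _ (h.pos 0).ne' (by positivity)]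
    ring
  rw [dist_comm, Real.dist_eq, hdiff, abs_div, abs_mul, abs_pow, abs_neg, abs_one, one_pow,
    one_mul, abs_of_pos (h.pos _), abs_of_pos (mul_pos (h.pos 0) (by positivity))]
  exact div_le_div_of_nonneg_left (h.pos _).le (h.pos 0) (le_mul_of_one_le_right (h.pos 0).le hden)

theorem ratio_lt_one (h : IsRemainderSequence d a) (k : ℕ) : a (k + 1) / a k < 1 :=
  (div_lt_one (h.pos k)).2 (h.strictAnti k.lt_succ_self)

theorem gaussMap_ratio (h : IsRemainderSequence d a) (k : ℕ) :
    gaussMap (a (k + 1) / a k) = a (k + 2) / a (k + 1) := by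
  rw [gaussMap, one_div_div, h.eq_add k, add_div, mul_div_cancel_right₀ _ (h.pos _).ne',
    Int.fract_natCast_add]
  exact Int.fract_eq_self.2 ⟨(div_pos (h.pos _) (h.pos _)).le, h.ratio_lt_one _⟩

theorem iterate_gaussMap_ratio (h : IsRemainderSequence d a) (k : ℕ) :
    gaussMap^[k] (a 1 / a 0) = a (k + 1) / a k := by
  induction k with
  | zero => rfl
  | succ k ih => rw [Function.iterate_succ_apply', ih, h.gaussMap_ratio]

end IsRemainderSequence

end ContinuedFraction

/-! ### The limit law -/

section LimitLaw

/-- The mean of `min u R` for a random variable `R` of mean one that takes the values `1 - ρ * κ`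
and `1 + (1 - ρ) * κ` with the probabilities `1 - ρ` and `ρ`. -/
def truncatedReturnMean (ρ κ u : ℝ) : ℝ :=
  (1 - ρ) * min u (1 - ρ * κ) + ρ * min u (1 + (1 - ρ) * κ)

theorem piecewiseLinearLaw_eq_truncatedReturnMean {ρ κ : ℝ} (hκ : 0 < κ)
    (hρκ : 0 ≤ 1 - ρ * κ) (t : ℝ) :
    piecewiseLinearLaw (1 - ρ * κ) (1 + (1 - ρ) * κ) t = truncatedReturnMean ρ κ (max t 0) := by
  have hlt : 1 - ρ * κ < 1 + (1 - ρ) * κ := by linarith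
  rw [piecewiseLinearLaw, truncatedReturnMean]
  split_ifs with hzero hfirst hsecond
  · rw [max_eq_right hzero, min_eq_left hρκ, min_eq_left (hρκ.trans hlt.le), mul_zero, mul_zero,
      add_zero]
  · rw [max_eq_left (by linarith), min_eq_left hfirst, min_eq_left (hfirst.trans hlt.le)]
    ring
  · rw [max_eq_left (by linarith), min_eq_right (by linarith), min_eq_left hsecond]
    have hκ0 := hκ.ne'
    rw [show 1 + (1 - ρ) * κ - (1 - ρ * κ) = κ by ring]
    field_simp
    ring
  · rw [max_eq_left (by linarith), min_eq_right (by linarith), min_eq_right (by linarith)]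
    ring

theorem continuous_truncatedReturnMean_fract :
    Continuous fun p : ℝ × ℝ × ℝ => truncatedReturnMean (Int.fract p.1) p.2.1 p.2.2 := by
  refine ContinuousOn.comp_fract
    (f := fun (p : ℝ × ℝ × ℝ) ρ => truncatedReturnMean ρ p.2.1 p.2.2)
    (Continuous.continuousOn ?_) continuous_fst fun p => ?_
  · simp only [Function.uncurry_def, truncatedReturnMean]
    fun_prop
  · simp only [truncatedReturnMean, zero_mul, sub_zero, sub_self, add_zero, one_mul, zero_add]

theorem continuous_piecewiseLinearLaw {ρ κ : ℝ} (hκ : 0 < κ) (hρκ : 0 ≤ 1 - ρ * κ) :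
    Continuous (piecewiseLinearLaw (1 - ρ * κ) (1 + (1 - ρ) * κ)) := by
  rw [funext (piecewiseLinearLaw_eq_truncatedReturnMean hκ hρκ)]
  unfold truncatedReturnMean
  fun_prop

variable {ι : Type*} {L : Filter ι}

theorem tendsto_natFloor_div_mul {a : ι → ℝ} (ha0 : ∀ i, 0 < a i) (ha : Tendsto a L (𝓝 0))
    (t : ℝ) : Tendsto (fun i => ⌊t / a i⌋₊ * a i) L (𝓝 (max t 0)) := by
  have hlow := ha.const_sub (max t 0)
  rw [sub_zero] at hlow
  refine tendsto_of_tendsto_of_tendsto_of_le_of_le hlow tendsto_const_nhds (fun i => ?_)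
    fun i => ?_
  · have hlt := (div_lt_iff₀ (ha0 i)).1 (Nat.lt_floor_add_one (t / a i))
    have hnonneg : 0 ≤ ⌊t / a i⌋₊ * a i := mul_nonneg (Nat.cast_nonneg _) (ha0 i).le
    exact sub_le_iff_le_add.2 (max_le (by linarith) (by linarith [ha0 i]))
  · calc ⌊t / a i⌋₊ * a i ≤ max (t / a i) 0 * a i :=
          mul_le_mul_of_nonneg_right ((Nat.cast_le.2 (Nat.floor_mono (le_max_left _ _))).trans
            (Nat.floor_le (le_max_right _ _))) (ha0 i).le
      _ = max t 0 := by
          rw [max_mul_of_nonneg _ _ (ha0 i).le, div_mul_cancel₀ _ (ha0 i).ne', zero_mul]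

theorem tendsto_fract_of_one_le {g : ι → ℝ} {γ : ℝ} (hg : Tendsto g L (𝓝 γ))
    (hg1 : ∀ i, 1 ≤ g i) (hγ1 : 1 ≤ γ) (hγ : ∀ m : ℕ, 2 ≤ m → γ ≠ m) :
    Tendsto (fun i => Int.fract (g i)) L (𝓝 (Int.fract γ)) := by
  rcases hγ1.eq_or_lt with rfl | hlt
  · rw [Int.fract_one]
    refine (by simpa using tendsto_fract_right' (α := ℝ) 1 : Tendsto _ (𝓝[≥] (1 : ℝ)) _).comp ?_
    exact tendsto_nhdsWithin_iff.2 ⟨hg, .of_forall hg1⟩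
  · refine (continuousAt_fract fun hint => ?_).tendsto.comp hg
    have htwo : 2 ≤ ⌊γ⌋ := by
      rw [hint] at hlt
      exact_mod_cast hlt
    refine hγ ⌊γ⌋.toNat (by omega) (hint.trans ?_)
    exact_mod_cast (Int.toNat_of_nonneg (by omega)).symm

end LimitLaw

/-! ### Masses of the cylinders in the limit -/

section SturmianLimit

variable {d pos : ℕ → ℕ} {hpos : ∀ k, 1 ≤ k → pos k ≤ d k}
  {μ : Measure (sturmianDiagram d pos hpos).PathSpace}

theorem sturmian_vertex_eq {x : (sturmianDiagram d pos hpos).PathSpace} {k : ℕ}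
    (hx : sturmianTerminal x (k + 1) = TwoVertices.one) : vertex (k + 1) x = TwoVertices.one :=
  (vertex_succ k x).trans hx

theorem measureReal_cylinder_eq_sturmianMass (hμ : MeasurePreserving vershik μ μ)
    {x : (sturmianDiagram d pos hpos).PathSpace} {k : ℕ}
    (hx : sturmianTerminal x (k + 1) = TwoVertices.one) :
    μ.real (cylinder x (k + 1)) = sturmianMass μ k := by
  rw [measureReal_cylinder hμ, sturmian_vertex_eq hx, sturmianMass]

variable [IsProbabilityMeasure μ]

theorem sturmianMass_pos (hμ : MeasurePreserving vershik μ μ) (hd : ∀ k, 1 ≤ k → 1 ≤ d k) (k : ℕ) :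
    0 < sturmianMass μ k := by
  have hnonneg (k : ℕ) : 0 ≤ sturmianMass μ k := measureReal_nonneg
  have hanti (k : ℕ) : sturmianMass μ (k + 1) ≤ sturmianMass μ k := by
    rw [sturmianMass_eq hμ k]
    exact le_add_of_le_of_nonneg (le_mul_of_one_le_left (hnonneg _)
      (Nat.one_le_cast.2 (hd _ k.succ_pos))) (hnonneg _)
  refine ((hnonneg (k + 1)).lt_of_ne' fun hzero => ?_).trans_le (hanti k)
  have htotal := cfSum_mul_sturmianMass hμ k
  rw [hzero, le_antisymm (hzero ▸ hanti (k + 1)) (hnonneg (k + 2)), mul_zero, mul_zero,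
    add_zero] at htotal
  exact zero_ne_one htotal

theorem isRemainderSequence_sturmianMass (hμ : MeasurePreserving vershik μ μ)
    (hd : ∀ k, 1 ≤ k → 1 ≤ d k) : IsRemainderSequence d (sturmianMass μ) where
  pos := sturmianMass_pos hμ hd
  strictAnti := strictAnti_nat_of_succ_lt fun k => by
    rw [sturmianMass_eq hμ k]
    exact (lt_add_of_pos_right _ (sturmianMass_pos hμ hd _)).trans_le' (le_mul_of_one_le_left
      (sturmianMass_pos hμ hd _).le (Nat.one_le_cast.2 (hd _ k.succ_pos)))
  eq_add := sturmianMass_eq hμ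

theorem iterate_gaussMap_eq_sturmianMass_div (hμ : MeasurePreserving vershik μ μ)
    (hd : ∀ k, 1 ≤ k → 1 ≤ d k) {β : ℝ}
    (hβ : Tendsto (fun k => (cfNum d k : ℝ) / cfDen d k) atTop (𝓝 β)) (k : ℕ) :
    gaussMap^[k] β = sturmianMass μ (k + 1) / sturmianMass μ k := by
  have ha := isRemainderSequence_sturmianMass hμ hd
  rw [tendsto_nhds_unique hβ ha.tendsto_convergents, ha.iterate_gaussMap_ratio]

theorem cfSum_mul_sturmianMass_eq_div (hμ : MeasurePreserving vershik μ μ)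
    (hd : ∀ k, 1 ≤ k → 1 ≤ d k) (k : ℕ) :
    cfSum d (k + 1) * sturmianMass μ (k + 2) =
      sturmianMass μ (k + 2) / sturmianMass μ (k + 1) /
        (1 + sturmianMass μ (k + 2) / sturmianMass μ (k + 1) *
          (cfSum d k / cfSum d (k + 1))) := by
  have hmass := (sturmianMass_pos hμ hd (k + 1)).ne'
  have hsum : (cfSum d (k + 1) : ℝ) ≠ 0 := Nat.cast_ne_zero.2 (cfSum_pos hd _).ne'
  have hden : 1 + sturmianMass μ (k + 2) / sturmianMass μ (k + 1) *
      (cfSum d k / cfSum d (k + 1)) = 1 / (sturmianMass μ (k + 1) * cfSum d (k + 1)) := by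
    field_simp
    linarith [cfSum_mul_sturmianMass hμ k]
  rw [hden]
  field_simp

theorem cfSum_succ_mul_sturmianMass (hμ : MeasurePreserving vershik μ μ)
    (hd : ∀ k, 1 ≤ k → 1 ≤ d k) (k : ℕ) :
    cfSum d (k + 1) * sturmianMass μ (k + 1) =
      1 - sturmianMass μ (k + 2) / sturmianMass μ (k + 1) *
        (cfSum d k * sturmianMass μ (k + 1)) := by
  have hmass := (sturmianMass_pos hμ hd (k + 1)).ne'
  have htotal := cfSum_mul_sturmianMass hμ k
  field_simp
  linarith

theorem entranceLaw_cylinder_eq_truncatedReturnMean (hμ : MeasurePreserving vershik μ μ)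
    (hd : ∀ k, 1 ≤ k → 1 ≤ d k) {x : (sturmianDiagram d pos hpos).PathSpace} {k : ℕ}
    (hx : sturmianTerminal x (k + 2) = TwoVertices.one) (t : ℝ) :
    entranceLaw μ vershik (cylinder x (k + 2)) t =
      truncatedReturnMean (sturmianMass μ (k + 2) / sturmianMass μ (k + 1))
        (cfSum d k * sturmianMass μ (k + 1))
        (⌊t / sturmianMass μ (k + 1)⌋₊ * sturmianMass μ (k + 1)) := by
  have hmass := sturmianMass_pos hμ hd (k + 1)
  have hbase : μ.real (towerLevel (B := sturmianDiagram d pos hpos) (k + 2) TwoVertices.one 0) =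
    sturmianMass μ (k + 1) := rfl
  have hlaw := entranceLaw_towerLevel_zero (B := sturmianDiagram d pos hpos) (n := k + 2) hμ
    TwoVertices.ne_one_iff (preimage_vershik_towerLevel_two_subset (hd (k + 2) (k + 1).succ_pos))
    hmass t
  rw [hbase, measureReal_towerLevel_two hμ (k + 1), sturmian_towerHeight_one,
    sturmian_towerHeight_two] at hlaw
  rw [entranceLaw_cylinder hμ, sturmian_vertex_eq hx, hlaw, truncatedReturnMean,
    ← cfSum_succ_mul_sturmianMass hμ hd,
    show 1 + (1 - sturmianMass μ (k + 2) / sturmianMass μ (k + 1)) *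
        (cfSum d k * sturmianMass μ (k + 1)) =
      (cfSum d (k + 1) + cfSum d k) * sturmianMass μ (k + 1) by
        linear_combination -cfSum_succ_mul_sturmianMass hμ hd k,
    ← min_mul_of_nonneg _ _ hmass.le, ← min_mul_of_nonneg _ _ hmass.le]
  field_simp

variable {K : Filter ℕ} {β w θ : ℝ}

theorem tendsto_cfSum_mul_sturmianMass (hμ : MeasurePreserving vershik μ μ)
    (hd : ∀ k, 1 ≤ k → 1 ≤ d k)
    (hβ : Tendsto (fun k => (cfNum d k : ℝ) / cfDen d k) atTop (𝓝 β)) (hK : K ≤ atTop)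
    (hw : Tendsto (fun k => (cfDen d k : ℝ) / cfDen d (k + 1)) K (𝓝 w))
    (hθ : Tendsto (fun k => gaussMap^[k + 1] β) K (𝓝 θ)) (hne : 1 + θ * w ≠ 0) :
    Tendsto (fun k => cfSum d (k + 1) * sturmianMass μ (k + 2)) K (𝓝 (θ / (1 + θ * w))) := by
  simp only [iterate_gaussMap_eq_sturmianMass_div hμ hd hβ] at hθ
  have hsum := tendsto_cfSum_div_cfSum hd hβ (tendsto_id'.2 hK)
    ((tendsto_add_atTop_nat 1).mono_left hK) hw
  exact (hθ.div ((hθ.mul hsum).const_add 1) hne).congr fun k =>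
    (cfSum_mul_sturmianMass_eq_div hμ hd k).symm

theorem sturmianMass_div_eq_fract (hμ : MeasurePreserving vershik μ μ)
    (hd : ∀ k, 1 ≤ k → 1 ≤ d k)
    (hβ : Tendsto (fun k => (cfNum d k : ℝ) / cfDen d k) atTop (𝓝 β)) (k : ℕ) :
    sturmianMass μ (k + 2) / sturmianMass μ (k + 1) = Int.fract (1 / gaussMap^[k] β) := by
  rw [iterate_gaussMap_eq_sturmianMass_div hμ hd hβ]
  exact ((isRemainderSequence_sturmianMass hμ hd).gaussMap_ratio k).symm

theorem iterate_gaussMap_mem_Ioo (hμ : MeasurePreserving vershik μ μ)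
    (hd : ∀ k, 1 ≤ k → 1 ≤ d k)
    (hβ : Tendsto (fun k => (cfNum d k : ℝ) / cfDen d k) atTop (𝓝 β)) (k : ℕ) :
    gaussMap^[k] β ∈ Set.Ioo 0 1 := by
  rw [iterate_gaussMap_eq_sturmianMass_div hμ hd hβ]
  exact ⟨div_pos (sturmianMass_pos hμ hd _) (sturmianMass_pos hμ hd _),
    (isRemainderSequence_sturmianMass hμ hd).ratio_lt_one k⟩

theorem tendsto_entranceLaw_cylinder (hμ : MeasurePreserving vershik μ μ)
    (hd : ∀ k, 1 ≤ k → 1 ≤ d k)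
    (hβ : Tendsto (fun k => (cfNum d k : ℝ) / cfDen d k) atTop (𝓝 β))
    {x : (sturmianDiagram d pos hpos).PathSpace} (hK : K ≤ atTop)
    (hx : ∀ᶠ k in K, sturmianTerminal x (k + 3) = TwoVertices.one)
    (hθ : Tendsto (fun k => gaussMap^[k + 1] β) K (𝓝 θ)) (hθ0 : θ ≠ 0) {κ : ℝ}
    (hκ : Tendsto (fun k => cfSum d (k + 1) * sturmianMass μ (k + 2)) K (𝓝 κ)) (t : ℝ) :
    Tendsto (fun k => entranceLaw μ vershik (cylinder x (k + 3)) t) K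
      (𝓝 (truncatedReturnMean (Int.fract (1 / θ)) κ (max t 0))) := by
  have hmass : Tendsto (fun k => sturmianMass μ (k + 2)) K (𝓝 0) :=
    ((tendsto_add_atTop_iff_nat 2).2
      (isRemainderSequence_sturmianMass hμ hd).tendsto_zero).mono_left hK
  have hfloor := tendsto_natFloor_div_mul (fun k => sturmianMass_pos hμ hd (k + 2)) hmass t
  have hinv : Tendsto (fun k => 1 / gaussMap^[k + 1] β) K (𝓝 (1 / θ)) :=
    tendsto_const_nhds.div hθ hθ0
  have hlaw := (continuous_truncatedReturnMean_fract.tendsto _).comp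
    (hinv.prodMk_nhds (hκ.prodMk_nhds hfloor))
  refine hlaw.congr' (hx.mono fun k hk =>
    Eq.trans ?_ (entranceLaw_cylinder_eq_truncatedReturnMean hμ hd hk t).symm)
  rw [sturmianMass_div_eq_fract hμ hd hβ]
  rfl

theorem cfSum_mul_measureReal_cylinder (hμ : MeasurePreserving vershik μ μ)
    (hd : ∀ k, 1 ≤ k → 1 ≤ d k)
    (hβ : Tendsto (fun k => (cfNum d k : ℝ) / cfDen d k) atTop (𝓝 β))
    {x : (sturmianDiagram d pos hpos).PathSpace} {k : ℕ}
    (hx : sturmianTerminal x (k + 2) = TwoVertices.one) :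
    cfSum d (k + 1) * μ.real (cylinder x (k + 2)) =
      1 - Int.fract (1 / gaussMap^[k] β) * (cfSum d k * sturmianMass μ (k + 1)) := by
  rw [measureReal_cylinder_eq_sturmianMass hμ hx, cfSum_succ_mul_sturmianMass hμ hd,
    sturmianMass_div_eq_fract hμ hd hβ]

theorem tendsto_cfSum_mul_measureReal_cylinder (hμ : MeasurePreserving vershik μ μ)
    (hd : ∀ k, 1 ≤ k → 1 ≤ d k)
    (hβ : Tendsto (fun k => (cfNum d k : ℝ) / cfDen d k) atTop (𝓝 β))
    {x : (sturmianDiagram d pos hpos).PathSpace} [K.NeBot]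
    (hx : ∀ᶠ k in K, sturmianTerminal x (k + 3) = TwoVertices.one)
    (hθ : Tendsto (fun k => gaussMap^[k + 1] β) K (𝓝 θ)) (hθ0 : 0 < θ)
    (hint : ∀ m : ℕ, 2 ≤ m → 1 / θ ≠ m) {κ : ℝ}
    (hκ : Tendsto (fun k => cfSum d (k + 1) * sturmianMass μ (k + 2)) K (𝓝 κ)) :
    Tendsto (fun k => cfSum d (k + 2) * μ.real (cylinder x (k + 3))) K
        (𝓝 (1 - Int.fract (1 / θ) * κ)) ∧
      Tendsto (fun k => (cfSum d (k + 2) + cfSum d (k + 1)) * μ.real (cylinder x (k + 3))) K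
        (𝓝 (1 + (1 - Int.fract (1 / θ)) * κ)) := by
  have hG (k : ℕ) := iterate_gaussMap_mem_Ioo hμ hd hβ (k + 1)
  have hinv : Tendsto (fun k => 1 / gaussMap^[k + 1] β) K (𝓝 (1 / θ)) :=
    tendsto_const_nhds.div hθ hθ0.ne'
  have hfract := tendsto_fract_of_one_le hinv (fun k => (one_le_div (hG k).1).2 (hG k).2.le)
    ((one_le_div hθ0).2 (le_of_tendsto' hθ fun k => (hG k).2.le)) hint
  have hshort : Tendsto (fun k => cfSum d (k + 2) * μ.real (cylinder x (k + 3))) K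
      (𝓝 (1 - Int.fract (1 / θ) * κ)) :=
    ((hfract.mul hκ).const_sub 1).congr' (hx.mono fun k hk =>
      (cfSum_mul_measureReal_cylinder hμ hd hβ hk).symm)
  refine ⟨hshort, ?_⟩
  rw [show 1 + (1 - Int.fract (1 / θ)) * κ = 1 - Int.fract (1 / θ) * κ + κ by ring]
  refine (hshort.add hκ).congr' (hx.mono fun k hk => ?_)
  dsimp only
  rw [measureReal_cylinder_eq_sturmianMass hμ hk, add_mul]

end SturmianLimit

section ReturnLimits

variable {θ w : ℝ}

theorem short_return_limit_eq (hθ : 0 < θ) (hw : 0 ≤ w) :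
    (⌊1 / θ⌋ + w) * θ / (1 + θ * w) = 1 - Int.fract (1 / θ) * (θ / (1 + θ * w)) := by
  have hden : 1 + θ * w ≠ 0 := by positivity
  rw [Int.fract, eq_sub_iff_add_eq, ← mul_div_assoc, ← add_div, div_eq_one_iff_eq hden]
  field_simp
  ring

theorem long_return_limit_eq (hθ : 0 < θ) (hw : 0 ≤ w) :
    (1 + ⌊1 / θ⌋ + w) * θ / (1 + θ * w) = 1 + (1 - Int.fract (1 / θ)) * (θ / (1 + θ * w)) := by
  linear_combination short_return_limit_eq hθ hw

theorem short_return_limit_pos (hθ : 0 < θ) (hθ1 : θ ≤ 1) (hw : 0 ≤ w) :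
    0 < (⌊1 / θ⌋ + w) * θ / (1 + θ * w) := by
  have hfloor : 0 < ⌊1 / θ⌋ := Int.floor_pos.2 ((one_le_div hθ).2 hθ1)
  positivity

end ReturnLimits

theorem mainTheorem4_general
    (d pos : ℕ → ℕ) (hd : ∀ k, 1 ≤ k → 1 ≤ d k) (hpos : ∀ k, 1 ≤ k → pos k ≤ d k)
    (μ : Measure (sturmianDiagram d pos hpos).PathSpace) [IsProbabilityMeasure μ]
    (hμ : MeasurePreserving vershik μ μ)
    (β : ℝ) (hβ : Tendsto (fun k => (cfNum d k : ℝ) / cfDen d k) atTop (𝓝 β))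
    (x : (sturmianDiagram d pos hpos).PathSpace)
    (L : Filter ℕ) [L.NeBot] (hL : L ≤ atTop)
    (hx : ∀ᶠ n in L, sturmianTerminal x n = TwoVertices.one)
    (w θ : ℝ) (hθ : 0 < θ)
    (hw_lim : Tendsto (fun n => (cfDen d (n - 3) : ℝ) / cfDen d (n - 2)) L (𝓝 w))
    (hθ_lim : Tendsto (fun n => gaussMap^[n - 2] β) L (𝓝 θ))
    (h₁ h₂ : ℝ) (hh₁ : h₁ = (⌊1 / θ⌋ + w) * θ / (1 + θ * w))
    (hh₂ : h₂ = (1 + ⌊1 / θ⌋ + w) * θ / (1 + θ * w)) :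
    (0 < h₁ ∧ h₁ ≤ 1 ∧ 1 ≤ h₂ ∧ h₁ < h₂) ∧
    Continuous (piecewiseLinearLaw h₁ h₂) ∧
    (∀ t : ℝ, Tendsto (fun n => entranceLaw μ vershik (cylinder x n) t) L
      (𝓝 (piecewiseLinearLaw h₁ h₂ t))) ∧
    ((∀ m : ℕ, 2 ≤ m → 1 / θ ≠ m) →
      Tendsto (fun n => ((cfNum d (n - 1) : ℝ) + cfDen d (n - 1)) * μ.real (cylinder x n)) L
        (𝓝 h₁) ∧
      Tendsto (fun n => ((cfNum d (n - 1) : ℝ) + cfDen d (n - 1) + cfNum d (n - 2) +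
          cfDen d (n - 2)) * μ.real (cylinder x n)) L (𝓝 h₂)) := by
  obtain ⟨K, rfl⟩ : ∃ K, L = map (· + 3) K := ⟨comap (· + 3) L, (map_comap_of_mem
    (hL (mem_atTop_sets.2 ⟨3, fun n hn => ⟨n - 3, Nat.sub_add_cancel hn⟩⟩))).symm⟩
  simp only [tendsto_map'_iff, Function.comp_def] at *
  have : K.NeBot := (map_neBot_iff _).1 ‹_›
  have hK : K ≤ atTop := tendsto_id'.1 ((tendsto_sub_atTop_nat 3).comp hL)
  have hw : 0 ≤ w := ge_of_tendsto' hw_lim fun k => by positivity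
  have hθ1 : θ ≤ 1 := le_of_tendsto' hθ_lim fun k => (iterate_gaussMap_mem_Ioo hμ hd hβ _).2.le
  have hκ := tendsto_cfSum_mul_sturmianMass hμ hd hβ hK hw_lim hθ_lim (by positivity)
  have hh₁0 : 0 < h₁ := hh₁ ▸ short_return_limit_pos hθ hθ1 hw
  rw [short_return_limit_eq hθ hw] at hh₁
  rw [long_return_limit_eq hθ hw] at hh₂
  set κ := θ / (1 + θ * w)
  have hκ0 : 0 < κ := by positivity
  subst hh₁ hh₂
  have hρ1 := Int.fract_lt_one (1 / θ)
  refine ⟨⟨hh₁0, sub_le_self _ (by positivity), le_add_of_nonneg_right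
    (mul_nonneg (sub_nonneg.2 hρ1.le) hκ0.le), by linarith⟩,
    continuous_piecewiseLinearLaw hκ0 hh₁0.le, fun t => ?_, fun hint => ?_⟩
  · rw [piecewiseLinearLaw_eq_truncatedReturnMean hκ0 hh₁0.le]
    exact tendsto_entranceLaw_cylinder hμ hd hβ hK hx hθ_lim hθ.ne' hκ t
  · have hreturn := tendsto_cfSum_mul_measureReal_cylinder hμ hd hβ hx hθ_lim hθ hint hκ
    simp only [cfSum, Nat.cast_add, ← add_assoc] at hreturn
    exact hreturn

theorem mainTheorem4
    (α : ℝ) (hα0 : 0 < α) (hα1 : α < 1) (hα : Irrational α)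
    (d pos : ℕ → ℕ) (hd : ∀ k, 1 ≤ k → 1 ≤ d k) (hpos : ∀ k, 1 ≤ k → pos k ≤ d k)
    (hproper : (sturmianDiagram d pos hpos).IsProperlyOrdered)
    (hrep : (sturmianDiagram d pos hpos).RepresentsSturmian α)
    (μ : Measure (sturmianDiagram d pos hpos).PathSpace) [IsProbabilityMeasure μ]
    (hμ : MeasurePreserving OrderedBratteliDiagram.vershik μ μ)
    (β : ℝ) (hβ : Tendsto (fun k => (cfNum d k : ℝ) / cfDen d k) atTop (𝓝 β))
    (x : (sturmianDiagram d pos hpos).PathSpace)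
    (M : Set ℕ) (hM : M.Infinite) (hM1 : ∀ n ∈ M, 1 ≤ n ∧ sturmianTerminal x n = TwoVertices.one)
    (w θ : ℝ) (hθ : 0 < θ)
    (hw_lim : Tendsto (fun n => (cfDen d (n - 3) : ℝ) / cfDen d (n - 2)) (atTop ⊓ 𝓟 M) (𝓝 w))
    (hθ_lim : Tendsto (fun n => gaussMap^[n - 2] β) (atTop ⊓ 𝓟 M) (𝓝 θ))
    (h₁ h₂ : ℝ) (hh₁ : h₁ = (⌊1 / θ⌋ + w) * θ / (1 + θ * w))
    (hh₂ : h₂ = (1 + ⌊1 / θ⌋ + w) * θ / (1 + θ * w)) :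
    (0 < h₁ ∧ h₁ ≤ 1 ∧ 1 ≤ h₂ ∧ h₁ < h₂) ∧
    Continuous (piecewiseLinearLaw h₁ h₂) ∧
    (∀ t : ℝ, Tendsto
      (fun n => entranceLaw μ OrderedBratteliDiagram.vershik (OrderedBratteliDiagram.cylinder x n) t)
      (atTop ⊓ 𝓟 M) (𝓝 (piecewiseLinearLaw h₁ h₂ t))) ∧
    ((∀ m : ℕ, 2 ≤ m → 1 / θ ≠ m) →
      Tendsto (fun n => ((cfNum d (n - 1) : ℝ) + cfDen d (n - 1)) *
          μ.real (OrderedBratteliDiagram.cylinder x n)) (atTop ⊓ 𝓟 M) (𝓝 h₁) ∧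
      Tendsto (fun n => ((cfNum d (n - 1) : ℝ) + cfDen d (n - 1) + cfNum d (n - 2) + cfDen d (n - 2)) *
          μ.real (OrderedBratteliDiagram.cylinder x n)) (atTop ⊓ 𝓟 M) (𝓝 h₂)) := by
  have : (atTop ⊓ 𝓟 M).NeBot :=
    frequently_mem_iff_neBot.1 (Nat.frequently_atTop_iff_infinite.2 hM)
  exact mainTheorem4_general d pos hd hpos μ hμ β hβ x (atTop ⊓ 𝓟 M) inf_le_left
    (mem_inf_of_right fun n hn => (hM1 n hn).2) w θ hθ hw_lim hθ_lim h₁ h₂ hh₁ hh₂
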